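/- Let $p>2$ be a prime and write $\mathbb{E}_{x\in X}$ for $\frac1{|X|}\sum_{x\in X}$. A quadratic factor $\mathcal{B}=(\mathcal{L},\mathcal{Q})$ on $\mathbb{F}_p^n$ of complexity $(\ell,q)$ consists of linearly independent vectors $r_1,\dots,r_\ell\in\mathbb{F}_p^n$ and symmetric $n\times n$ matrices $M_1,\dots,M_q$ over $\mathbb{F}_p$. Its rank is the minimum of $\mathrm{rk}(\lambda_1M_1+\dots+\lambda_qM_q)$ over $\lambda\in\mathbb{F}_p^q\setminus\{0\}$ (it is $\infty$ if $q=0$). For $a=(a',a'')\in\mathbb{F}_p^{\ell}\times\mathbb{F}_p^{q}$ and $b\in\mathbb{F}_p^q$ put $$B(a)=\{x: x^Tr_i=a'_i\ (i\le \ell),\ x^TM_jx=a''_j\ (j\le q)\},\qquad \beta(b)=\{(x,y): x^TM_jy=b_j\ (j\le q)\},$$ and $\mu_{\beta}(x,y)=1_{\beta}(x,y)\,p^{2n}/|\beta|$. For a tuple $d=(a_1,a_2,a_3,b_{12},b_{13},b_{23})\in(\mathbb{F}_p^{\ell+q})^3\times(\mathbb{F}_p^q)^3$ let $\Sigma(d)=a_1+a_2+a_3+2(0,b_{12})+2(0,b_{13})+2(0,b_{23})$.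 For $f:\mathbb{F}_p^n\to\mathbb{C}$ define $\|f\|_{U^3(d)}\ge 0$ by $$\|f\|_{U^3(d)}^8=\mathbb{E}_{x_0,x_1\in B(a_1)}\mathbb{E}_{y_0,y_1\in B(a_2)}\mathbb{E}_{z_0,z_1\in B(a_3)}\prod_{i,j}\mu_{\beta(b_{12})}(x_i,y_j)\prod_{i,k}\mu_{\beta(b_{13})}(x_i,z_k)\prod_{j,k}\mu_{\beta(b_{23})}(y_j,z_k)\prod_{\omega\in\{0,1\}^3}\mathcal{C}^{|\omega|}f(x_{\omega(1)}+y_{\omega(2)}+z_{\omega(3)}),$$ where $i,j,k$ range over $\{0,1\}$, $\mathcal{C}$ is complex conjugation and $|\omega|=\omega(1)+\omega(2)+\omega(3)$. A growth function is an increasing function $\mathbb{R}^+\to\mathbb{R}^+$, and inequalities between growth functions are pointwise. **Proposition (counting lemma for induced ternary sums across quadratic atoms).** For every positive integer $m$ there is a constant $C=C(m)>0$ such that for all $\varepsilon>0$ there is a growth function $\tau_0=\tau_0(m,\varepsilon)$ such that the following holds for every growth function $\tau\ge\tau_0$ and every prime $p>2$. Let $U,V,W\subseteq[m]$ and let $F$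 be a $3$-partite $3$-uniform hypergraph with vertex classes (disjoint copies of) $U,V,W$ and edge set $E_F$. Let $\mathcal{B}$ be a quadratic factor on $\mathbb{F}_p^n$ of complexity $(\ell,q)$ and rank at least $\tau(\ell+q)$, and let $A\subseteq\mathbb{F}_p^n$, with complement $A^C$. Let $a_u,b_v,c_w\in\mathbb{F}_p^{\ell+q}$ and $d_{uv},d_{uw},d_{vw}\in\mathbb{F}_p^q$ be labels for $u\in U$, $v\in V$, $w\in W$, let $e_{uvw}=(a_u,b_v,c_w,d_{uv},d_{uw},d_{vw})$ and $e=(e_{uvw})$, and let $\alpha_{uvw}=|A\cap B(\Sigma(e_{uvw}))|/|B(\Sigma(e_{uvw}))|$. Suppose that $\|1_A-\alpha_{uvw}\|_{U^3(e_{uvw})}\le\varepsilon$ for all $(u,v,w)\in U\times V\times W$. Put $$P=\prod_{uvw\in E_F}\alpha_{uvw}\prod_{uvw\notin E_F}(1-\alpha_{uvw}),$$ and $$T=\mathbb{E}_{x_u\in B(a_u):u\in U}\ \mathbb{E}_{y_v\in B(b_v):v\in V}\ \mathbb{E}_{z_w\in B(c_w):w\in W}\ \prod_{u,v}\mu_{\beta(d_{uv})}(x_u,y_v)\prod_{u,w}\mu_{\beta(d_{uw})}(x_u,z_w)\prod_{v,w}\mu_{\beta(d_{vw})}(y_v,z_w)\prod_{u,v,w}f_{uvw}(x_u+y_v+z_w),$$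 where $f_{uvw}=1_A$ if $uvw\in E_F$ and $f_{uvw}=1_{A^C}$ if $uvw\notin E_F$. Then $$|T-P|<3\varepsilon m^3.$$ Moreover, let $\mathcal{I}_F(e)$ be the set of tuples $((x_u)_{u\in U},(y_v)_{v\in V},(z_w)_{w\in W})$ in $\prod_uB(a_u)\times\prod_vB(b_v)\times\prod_wB(c_w)$ such that $(x_u,y_v)\in\beta(d_{uv})$, $(x_u,z_w)\in\beta(d_{uw})$ and $(y_v,z_w)\in\beta(d_{vw})$ for all $(u,v,w)\in U\times V\times W$. Then the number of tuples in $\mathcal{I}_F(e)$ such that, for all $(u,v,w)$, $x_u+y_v+z_w\in A$ if and only if $uvw\in E_F$, differs from $P\,|\mathcal{I}_F(e)|$ by at most $C\varepsilon\,|\mathcal{I}_F(e)|$. -/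

import Mathlib

open Finset
open scoped BigOperators

namespace TernaryCount

/-- The vector space `𝔽_p^n`. -/
abbrev Vec (p n : ℕ) : Type := Fin n → ZMod p

/-- A growth function `ℝ⁺ → ℝ⁺`: increasing and positive on the positive reals
(values outside the positive reals are irrelevant). -/
def IsGrowthFunction (τ : ℝ → ℝ) : Prop :=
  MonotoneOn τ (Set.Ioi 0) ∧ ∀ x, 0 < x → 0 < τ x

/-- A quadratic factor `(𝓛, 𝓠)` on `𝔽_p^n` of complexity `(ℓ, q)`: linearly independent vectors
`r_1, …, r_ℓ` and symmetric matrices `M_1, …, M_q`. -/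
structure QuadraticFactor (p n l q : ℕ) where
  r : Fin l → Vec p n
  linearIndependent : LinearIndependent (ZMod p) r
  M : Fin q → Matrix (Fin n) (Fin n) (ZMod p)
  isSymm : ∀ j, (M j).IsSymm

/-- Labels in `𝔽_p^{ℓ+q} = 𝔽_p^ℓ × 𝔽_p^q` of quadratic atoms. -/
abbrev AtomLabel (p l q : ℕ) : Type := (Fin l → ZMod p) × (Fin q → ZMod p)

/-- A tuple `(a_1, a_2, a_3, b_12, b_13, b_23)` of three atom labels and three labels in `𝔽_p^q`
of bilinear level sets. -/
structure SixLabel (p l q : ℕ) where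
  a₁ : AtomLabel p l q
  a₂ : AtomLabel p l q
  a₃ : AtomLabel p l q
  b₁₂ : Fin q → ZMod p
  b₁₃ : Fin q → ZMod p
  b₂₃ : Fin q → ZMod p

/-- `Σ(d) = a_1 + a_2 + a_3 + 2(0 b_12) + 2(0 b_13) + 2(0 b_23)`, where `0 b` is `b` preceded
by `ℓ` zeros. -/
def SixLabel.sigma {p l q : ℕ} (d : SixLabel p l q) : AtomLabel p l q :=
  d.a₁ + d.a₂ + d.a₃ + (2 : ℕ) • ((0, d.b₁₂) : AtomLabel p l q)
    + (2 : ℕ) • ((0, d.b₁₃) : AtomLabel p l q) + (2 : ℕ) • ((0, d.b₂₃) : AtomLabel p l q)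

namespace QuadraticFactor

/-- The rank of the factor: the minimum of `rk(λ_1 M_1 + … + λ_q M_q)` over `λ ≠ 0`
(it is `⊤` if `q = 0`). -/
noncomputable def rank {p n l q : ℕ} (B : QuadraticFactor p n l q) : EReal :=
  ⨅ (c : Fin q → ZMod p) (_ : c ≠ 0), (((∑ j, c j • B.M j).rank : ℝ) : EReal)

variable {p n l q : ℕ} [Fact p.Prime]

/-- The atom `B(a) = {x : x^T r_i = a_i, x^T M_j x = a'_j}` with label `(a, a')`. -/
def atom (B : QuadraticFactor p n l q) (a : AtomLabel p l q) : Finset (Vec p n) :=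
  univ.filter fun x =>
    (∀ i, dotProduct x (B.r i) = a.1 i) ∧ ∀ j, dotProduct x ((B.M j).mulVec x) = a.2 j

/-- The bilinear level set `β(b) = {(x, y) : x^T M_j y = b_j}`. -/
def beta (B : QuadraticFactor p n l q) (b : Fin q → ZMod p) : Finset (Vec p n × Vec p n) :=
  univ.filter fun z => ∀ j, dotProduct z.1 ((B.M j).mulVec z.2) = b j

/-- The characteristic measure `μ_{β(b)}(x, y) = 1_{β(b)}(x, y) |𝔽_p^n|² / |β(b)|`. -/
noncomputable def mu (B : QuadraticFactor p n l q) (b : Fin q → ZMod p) (x y : Vec p n) : ℝ :=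
  if (x, y) ∈ B.beta b then (Fintype.card (Vec p n) : ℝ) ^ 2 / ((B.beta b).card : ℝ) else 0

/-- The density of `A` on the atom `B(a)`. -/
noncomputable def density (B : QuadraticFactor p n l q) (A : Finset (Vec p n))
    (a : AtomLabel p l q) : ℝ :=
  ((A ∩ B.atom a).card : ℝ) / ((B.atom a).card : ℝ)

/-- The local `U³` inner product of `(f_ω)_{ω ∈ {0,1}³}` with respect to the tuple `d`. -/
noncomputable def localU3Inner (B : QuadraticFactor p n l q) (d : SixLabel p l q)
    (f : Fin 2 × Fin 2 × Fin 2 → Vec p n → ℂ) : ℂ :=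
  𝔼 x ∈ Fintype.piFinset fun _ : Fin 2 => B.atom d.a₁,
  𝔼 y ∈ Fintype.piFinset fun _ : Fin 2 => B.atom d.a₂,
  𝔼 z ∈ Fintype.piFinset fun _ : Fin 2 => B.atom d.a₃,
    (∏ i, ∏ j, (B.mu d.b₁₂ (x i) (y j) : ℂ)) *
    (∏ i, ∏ k, (B.mu d.b₁₃ (x i) (z k) : ℂ)) *
    (∏ j, ∏ k, (B.mu d.b₂₃ (y j) (z k) : ℂ)) *
    ∏ ω : Fin 2 × Fin 2 × Fin 2,
      (starRingEnd ℂ)^[(ω.1 : ℕ) + (ω.2.1 : ℕ) + (ω.2.2 : ℕ)]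
        (f ω (x ω.1 + y ω.2.1 + z ω.2.2))

/-- The local `U³` semi-norm `‖f‖_{U³(d)}`, the eighth root of the inner product of eight copies
of `f`, which is a nonnegative real number (see `localU3Inner_self_nonneg`). -/
noncomputable def localU3Norm (B : QuadraticFactor p n l q) (d : SixLabel p l q)
    (f : Vec p n → ℂ) : ℝ :=
  (B.localU3Inner d fun _ => f).re ^ (1 / 8 : ℝ)

theorem mu_nonneg (B : QuadraticFactor p n l q) (b : Fin q → ZMod p) (x y : Vec p n) :
    0 ≤ B.mu b x y := by
  unfold mu; split_ifs <;> positivity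

open ComplexOrder in
theorem localU3Inner_self_nonneg (B : QuadraticFactor p n l q) (d : SixLabel p l q)
    (f : Vec p n → ℂ) : 0 ≤ B.localU3Inner d fun _ => f := by
  unfold localU3Inner
  refine Finset.expect_nonneg fun x _ => Finset.expect_nonneg fun y _ => ?_
  let P : Vec p n → ℂ := fun z =>
    ((∏ i, (B.mu d.b₁₃ (x i) z : ℂ)) * ∏ j, (B.mu d.b₂₃ (y j) z : ℂ)) *
      ∏ i : Fin 2, ∏ j : Fin 2, (starRingEnd ℂ)^[(i : ℕ) + (j : ℕ)] (f (x i + y j + z))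
  let g : Fin 2 → Vec p n → ℂ := fun k z => (starRingEnd ℂ)^[(k : ℕ)] (P z)
  have key : ∀ z : Fin 2 → Vec p n,
      (∏ i, ∏ j, (B.mu d.b₁₂ (x i) (y j) : ℂ)) *
      (∏ i, ∏ k, (B.mu d.b₁₃ (x i) (z k) : ℂ)) *
      (∏ j, ∏ k, (B.mu d.b₂₃ (y j) (z k) : ℂ)) *
      ∏ ω : Fin 2 × Fin 2 × Fin 2,
        (starRingEnd ℂ)^[(ω.1 : ℕ) + (ω.2.1 : ℕ) + (ω.2.2 : ℕ)]
          (f (x ω.1 + y ω.2.1 + z ω.2.2))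
      = (∏ i, ∏ j, (B.mu d.b₁₂ (x i) (y j) : ℂ)) * ∏ k, g k (z k) := by
    intro z
    simp only [g, P, Fintype.prod_prod_type, Fin.prod_univ_two, Fin.val_zero, Fin.val_one,
      Function.iterate_succ, Function.iterate_zero, Function.comp, id, map_mul,
      Complex.conj_conj, Complex.conj_ofReal, add_zero]
    ring
  rw [Finset.expect, Finset.sum_congr rfl fun z _ => key z, ← Finset.mul_sum,
    ← Finset.prod_univ_sum, Fin.prod_univ_two fun k => ∑ z ∈ B.atom d.a₃, g k z]
  have hg : ∑ z ∈ B.atom d.a₃, g 1 z = (starRingEnd ℂ) (∑ z ∈ B.atom d.a₃, g 0 z) := by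
    simp [g, map_sum]
  have hmu : (0 : ℂ) ≤ ∏ i, ∏ j, (B.mu d.b₁₂ (x i) (y j) : ℂ) :=
    Finset.prod_nonneg fun i _ => Finset.prod_nonneg fun j _ => by
      exact_mod_cast B.mu_nonneg _ _ _
  rw [hg, Complex.mul_conj]
  exact smul_nonneg (by positivity) (mul_nonneg hmu (by exact_mod_cast Complex.normSq_nonneg _))

end QuadraticFactor

/-- A 3-partite 3-uniform hypergraph with (pairwise disjoint) vertex classes `U`, `V`, `W`: every
edge consists of one vertex from each class. -/
structure TripartiteHypergraph (U V W : Type*) where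
  edges : Set (Set (U ⊕ V ⊕ W))
  tripartite : ∀ s ∈ edges, ∃ u v w, s = {Sum.inl u, Sum.inr (Sum.inl v), Sum.inr (Sum.inr w)}

/-- `uvw` is an edge. -/
def TripartiteHypergraph.IsEdge {U V W : Type*} (F : TripartiteHypergraph U V W)
    (u : U) (v : V) (w : W) : Prop :=
  {Sum.inl u, Sum.inr (Sum.inl v), Sum.inr (Sum.inr w)} ∈ F.edges

/-- A family `e = (e_{uvw})` of label tuples
`e_{uvw} = (a_u, b_v, c_w, d_{uv}, d_{uw}, d_{vw})`. -/
structure LabelFamily (p l q : ℕ) (U V W : Type*) where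
  a : U → AtomLabel p l q
  b : V → AtomLabel p l q
  c : W → AtomLabel p l q
  dUV : U → V → Fin q → ZMod p
  dUW : U → W → Fin q → ZMod p
  dVW : V → W → Fin q → ZMod p

/-- The tuple `e_{uvw}`. -/
def LabelFamily.tuple {p l q : ℕ} {U V W : Type*} (e : LabelFamily p l q U V W)
    (u : U) (v : V) (w : W) : SixLabel p l q :=
  ⟨e.a u, e.b v, e.c w, e.dUV u v, e.dUW u w, e.dVW v w⟩

section Operators

variable {p n l q : ℕ} [Fact p.Prime] {U V W : Type*} [Fintype U] [Fintype V] [Fintype W]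
  [DecidableEq U] [DecidableEq V] [DecidableEq W]

/-- The ternary multi-local operator `T_{F(e)}((f_{u,v,w}))`. -/
noncomputable def ternaryOp (B : QuadraticFactor p n l q) (e : LabelFamily p l q U V W)
    (f : U → V → W → Vec p n → ℂ) : ℂ :=
  𝔼 x ∈ Fintype.piFinset fun u => B.atom (e.a u),
  𝔼 y ∈ Fintype.piFinset fun v => B.atom (e.b v),
  𝔼 z ∈ Fintype.piFinset fun w => B.atom (e.c w),
    (∏ u, ∏ v, (B.mu (e.dUV u v) (x u) (y v) : ℂ)) *
    (∏ u, ∏ w, (B.mu (e.dUW u w) (x u) (z w) : ℂ)) *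
    (∏ v, ∏ w, (B.mu (e.dVW v w) (y v) (z w) : ℂ)) *
    ∏ u, ∏ v, ∏ w, f u v w (x u + y v + z w)

open Classical in
/-- `T_{F(e)}(f | g)`: the input function is `f` on edges of `F` and `g` on non-edges. -/
noncomputable def ternaryOpPair (F : TripartiteHypergraph U V W) (B : QuadraticFactor p n l q)
    (e : LabelFamily p l q U V W) (f g : Vec p n → ℂ) : ℂ :=
  ternaryOp B e fun u v w => if F.IsEdge u v w then f else g

open Classical in
/-- `∏_{uvw ∈ E} α_{uvw} ∏_{uvw ∉ E} (1 - α_{uvw})`. -/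
noncomputable def edgeProduct (F : TripartiteHypergraph U V W) (α : U → V → W → ℝ) : ℝ :=
  (∏ t : U × V × W with F.IsEdge t.1 t.2.1 t.2.2, α t.1 t.2.1 t.2.2) *
    ∏ t : U × V × W with ¬ F.IsEdge t.1 t.2.1 t.2.2, (1 - α t.1 t.2.1 t.2.2)

/-- The set `𝓘_F(e)` of tuples `((x_u), (y_v), (z_w))` lying in the atoms and bilinear level sets
prescribed by `e`. -/
def tupleSet (B : QuadraticFactor p n l q) (e : LabelFamily p l q U V W) :
    Set ((U → Vec p n) × (V → Vec p n) × (W → Vec p n)) :=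
  {t | (∀ u, t.1 u ∈ B.atom (e.a u)) ∧ (∀ v, t.2.1 v ∈ B.atom (e.b v)) ∧
    (∀ w, t.2.2 w ∈ B.atom (e.c w)) ∧
    ∀ u v w, (t.1 u, t.2.1 v) ∈ B.beta (e.dUV u v) ∧ (t.1 u, t.2.2 w) ∈ B.beta (e.dUW u w) ∧
      (t.2.1 v, t.2.2 w) ∈ B.beta (e.dVW v w)}

/-- The tuples in `𝓘_F(e)` that induce a copy of `F`:
`x_u + y_v + z_w ∈ A` if and only if `uvw` is an edge. -/
def inducedCopies (F : TripartiteHypergraph U V W) (B : QuadraticFactor p n l q)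
    (e : LabelFamily p l q U V W) (A : Finset (Vec p n)) :
    Set ((U → Vec p n) × (V → Vec p n) × (W → Vec p n)) :=
  {t | t ∈ tupleSet B e ∧ ∀ u v w, t.1 u + t.2.1 v + t.2.2 w ∈ A ↔ F.IsEdge u v w}

end Operators

/-- The indicator function `1_A`. -/
noncomputable def ind {p n : ℕ} (A : Finset (Vec p n)) (x : Vec p n) : ℂ :=
  if x ∈ A then 1 else 0

end TernaryCount

/-!
Weyl differencing bounds the exponential sums of quadratic forms of high rank, so by Fourier
inversion the values of the forms of a factor of high rank on any system of at most `6m` vectors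
are equidistributed. Consequently the characteristic measures of the bilinear level sets are
jointly quasirandom, even after every vertex is doubled. Each entry `1_A` or `1_{Aᶜ}` is then
replaced by its mean `α` or `1 - α`, one at a time: the difference has an entry `±(1_A - α)`, and
three applications of the Cauchy–Schwarz inequality, one for each vertex of that entry, bound it by
`‖1_A - α‖_{U³(e_{uvw})}` up to an error that vanishes as the rank grows. For the count, `T` is the
number of induced copies times a common weight, and `T ≈ 1` when all the entries are `1`.
-/

namespace TernaryCount

open scoped Matrix

section Averages

variable {J K X M : Type*} [AddCommMonoid M] [Module ℚ≥0 M]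

theorem expect_comp_of_involutive {s : Finset J} {σ : J → J} (hσ : Function.Involutive σ)
    (hs : ∀ i ∈ s, σ i ∈ s) (f : J → M) : 𝔼 i ∈ s, f (σ i) = 𝔼 i ∈ s, f i :=
  expect_nbij' σ σ hs hs (fun i _ => hσ i) (fun i _ => hσ i) fun _ _ => rfl

variable [Fintype J] [DecidableEq J] [Fintype K] [DecidableEq K]

theorem piecewise_mem_piFinset {D : J → Finset X} {x t : J → X} (ht : t ∈ Fintype.piFinset D)
    (hx : x ∈ Fintype.piFinset D) (A : Finset J) : A.piecewise t x ∈ Fintype.piFinset D := by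
  rw [Fintype.mem_piFinset] at *
  exact fun j => A.piecewise_cases t x (· ∈ D j) (ht j) (hx j)

theorem expect_piecewise (D : J → Finset X) (A : Finset J) (h : (J → X) → M) :
    𝔼 x ∈ Fintype.piFinset D, 𝔼 t ∈ Fintype.piFinset D, h (A.piecewise t x)
      = 𝔼 x ∈ Fintype.piFinset D, h x := by
  rcases (Fintype.piFinset D).eq_empty_or_nonempty with hD | hD
  · simp [hD]
  have hσ : Function.Involutive fun z : (J → X) × (J → X) =>
      (A.piecewise z.2 z.1, A.piecewise z.1 z.2) := fun z => by
    ext j <;> by_cases hj : j ∈ A <;> simp [hj]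
  calc
    _ = 𝔼 x ∈ Fintype.piFinset D, 𝔼 _t ∈ Fintype.piFinset D, h x := by
      rw [← expect_product', ← expect_product']
      refine expect_comp_of_involutive hσ (fun z hz => ?_) fun z => h z.1
      rw [mem_product] at hz ⊢
      exact ⟨piecewise_mem_piFinset hz.2 hz.1 A, piecewise_mem_piFinset hz.1 hz.2 A⟩
    _ = _ := by simp only [expect_const hD]

theorem expect_comp_injective {D : J → Finset X} (hD : ∀ j, (D j).Nonempty) {i : K → J}
    (hi : Function.Injective i) (h : (K → X) → M) :
    𝔼 x ∈ Fintype.piFinset D, h (x ∘ i) = 𝔼 y ∈ Fintype.piFinset (D ∘ i), h y := by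
  have hσ : Function.Involutive fun z : (K → X) × (J → X) =>
      (z.2 ∘ i, Function.extend i z.1 z.2) := fun z => by
    ext j
    · simp [hi.extend_apply]
    · by_cases hj : ∃ k, i k = j
      · obtain ⟨k, rfl⟩ := hj
        simp [hi.extend_apply]
      · simp [Function.extend_apply' _ _ _ hj]
  calc
    _ = 𝔼 _y ∈ Fintype.piFinset (D ∘ i), 𝔼 x ∈ Fintype.piFinset D, h (x ∘ i) := by
      rw [expect_const (s := Fintype.piFinset (D ∘ i))
        (Fintype.piFinset_nonempty.2 fun k => hD (i k))]
    _ = 𝔼 y ∈ Fintype.piFinset (D ∘ i), 𝔼 _x ∈ Fintype.piFinset D, h y := by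
      rw [← expect_product', ← expect_product']
      refine expect_comp_of_involutive hσ (fun z hz => ?_) fun z => h z.1
      simp only [mem_product, Fintype.mem_piFinset, Function.comp_apply] at hz ⊢
      refine ⟨fun k => hz.2 (i k), fun j => ?_⟩
      by_cases hj : ∃ k, i k = j
      · obtain ⟨k, rfl⟩ := hj
        rw [hi.extend_apply]
        exact hz.1 k
      · rw [Function.extend_apply' _ _ _ hj]
        exact hz.2 j
    _ = _ := by simp only [expect_const (Fintype.piFinset_nonempty.2 hD)]

theorem norm_sq_expect_mul_le {ι : Type*} (s : Finset ι) {w : ι → ℝ} (hw : ∀ x, 0 ≤ w x)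
    (H : ι → ℂ) :
    ‖𝔼 x ∈ s, (w x : ℂ) * H x‖ ^ 2 ≤ (𝔼 x ∈ s, w x) * 𝔼 x ∈ s, w x * ‖H x‖ ^ 2 := by
  have hnorm : ‖𝔼 x ∈ s, (w x : ℂ) * H x‖ ≤ 𝔼 x ∈ s, √(w x) * (√(w x) * ‖H x‖) := by
    refine (RCLike.norm_expect_le (K := ℂ)).trans (expect_le_expect fun x _ => ?_)
    rw [norm_mul, Complex.norm_real, Real.norm_of_nonneg (hw x), ← mul_assoc,
      Real.mul_self_sqrt (hw x)]
  calc
    _ ≤ (𝔼 x ∈ s, √(w x) * (√(w x) * ‖H x‖)) ^ 2 := by gcongr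
    _ ≤ (𝔼 x ∈ s, √(w x) ^ 2) * 𝔼 x ∈ s, (√(w x) * ‖H x‖) ^ 2 :=
      expect_mul_sq_le_sq_mul_sq s _ _
    _ = _ := by simp only [mul_pow, Real.sq_sqrt (hw _)]

/-- The average of `G` over the coordinates in `A`, with the other coordinates frozen at `x`:
the conditional expectation of `G` given the coordinates outside `A`. -/
noncomputable def fiberExpect (D : J → Finset X) (A : Finset J) (G : (J → X) → ℂ) (x : J → X) :
    ℂ :=
  𝔼 t ∈ Fintype.piFinset D, G (A.piecewise t x)

theorem fiberExpect_piecewise (D : J → Finset X) (A : Finset J) (G : (J → X) → ℂ)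
    (x t : J → X) : fiberExpect D A G (A.piecewise t x) = fiberExpect D A G x := by
  simp only [fiberExpect, piecewise_idem_right]

theorem expect_mul_fiberExpect (D : J → Finset X) (A : Finset J) {h : (J → X) → ℂ}
    (hh : ∀ x t, h (A.piecewise t x) = h x) (G : (J → X) → ℂ) :
    𝔼 x ∈ Fintype.piFinset D, h x * fiberExpect D A G x
      = 𝔼 x ∈ Fintype.piFinset D, h x * G x := by
  rw [← expect_piecewise D A fun x => h x * G x]
  simp only [hh, fiberExpect, mul_expect]

theorem fiberExpect_image (D : J → Finset X) {π : J → J} (hπ : Function.Involutive π)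
    (hD : ∀ j, D (π j) = D j) {A : Finset J} {G : (J → X) → ℂ}
    (hG : DependsOn G {j | π j ∉ A}) (x : J → X) :
    fiberExpect D (A.image π) (fun y => G (A.piecewise (y ∘ π) y)) x = fiberExpect D A G x := by
  have hmem (j : J) : j ∈ A.image π ↔ π j ∈ A := by
    rw [mem_image]
    exact ⟨by rintro ⟨k, hk, rfl⟩; rwa [hπ k], fun h => ⟨π j, h, hπ j⟩⟩
  unfold fiberExpect
  rw [← expect_comp_of_involutive (σ := fun t : J → X => t ∘ π)
    (fun t => by ext j; simp [hπ j]) fun t ht => ?_]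
  · refine expect_congr rfl fun t _ => hG fun j hj => ?_
    by_cases hjA : j ∈ A
    · simp only [piecewise_eq_of_mem _ _ _ hjA, Function.comp_apply, hπ j,
        piecewise_eq_of_mem _ _ _ ((hmem (π j)).2 ((hπ j).symm ▸ hjA))]
    · simp only [piecewise_eq_of_notMem _ _ _ hjA, piecewise_eq_of_notMem _ _ _ (mt (hmem j).1 hj)]
  · rw [Fintype.mem_piFinset] at ht ⊢
    exact fun j => hD j ▸ ht (π j)

open ComplexConjugate in
theorem expect_mul_norm_sq_fiberExpect (D : J → Finset X) {π : J → J}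
    (hπ : Function.Involutive π) (hD : ∀ j, D (π j) = D j) {A : Finset J} {w : (J → X) → ℝ}
    {G : (J → X) → ℂ} (hw : DependsOn w {j | j ∉ A ∧ π j ∉ A})
    (hG : DependsOn G {j | π j ∉ A}) :
    ((𝔼 x ∈ Fintype.piFinset D, w x * ‖fiberExpect D A G x‖ ^ 2 : ℝ) : ℂ)
      = 𝔼 x ∈ Fintype.piFinset D, (w x : ℂ) * (G x * conj (G (A.piecewise (x ∘ π) x))) := by
  have hw' (x t : J → X) : w (A.piecewise t x) = w x := hw fun j hj => by simp [hj.1]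
  have hnotMem {j : J} (hj : π j ∉ A) : j ∉ A.image π := fun h => by
    obtain ⟨k, hk, rfl⟩ := mem_image.1 h
    exact hj (by rwa [hπ k])
  calc
    _ = 𝔼 x ∈ Fintype.piFinset D,
        (w x * conj (fiberExpect D A G x) : ℂ) * fiberExpect D A G x := by
      rw [Complex.ofReal_expect]
      refine expect_congr rfl fun x _ => ?_
      rw [mul_assoc, Complex.conj_mul', Complex.ofReal_mul, Complex.ofReal_pow]
    _ = 𝔼 x ∈ Fintype.piFinset D, (w x * conj (fiberExpect D A G x) : ℂ) * G x :=
      expect_mul_fiberExpect D A (fun x t => by rw [hw', fiberExpect_piecewise]) G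
    _ = 𝔼 x ∈ Fintype.piFinset D, (w x * G x : ℂ) *
        fiberExpect D (A.image π) (fun y => conj (G (A.piecewise (y ∘ π) y))) x := by
      refine expect_congr rfl fun x _ => ?_
      have hconj := fiberExpect_image D hπ hD (G := fun x => conj (G x))
        (fun x y hxy => congrArg conj (hG hxy)) x
      rw [hconj, fiberExpect, fiberExpect, map_expect (starRingEnd ℂ)]
      ring
    _ = 𝔼 x ∈ Fintype.piFinset D, (w x * G x : ℂ) * conj (G (A.piecewise (x ∘ π) x)) :=
      expect_mul_fiberExpect D (A.image π) (fun x t => by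
        rw [hw fun j hj => piecewise_eq_of_notMem _ _ _ (hnotMem hj.2),
          hG fun j hj => piecewise_eq_of_notMem _ _ _ (hnotMem hj)]) _
    _ = _ := by simp only [mul_assoc]

open ComplexConjugate in
theorem norm_sq_expect_le (D : J → Finset X) {π : J → J} (hπ : Function.Involutive π)
    (hD : ∀ j, D (π j) = D j) {A : Finset J} {w : (J → X) → ℝ} (hw₀ : ∀ x, 0 ≤ w x)
    {g G : (J → X) → ℂ} (hg₁ : ∀ x, ‖g x‖ ≤ 1) (hw : DependsOn w {j | j ∉ A ∧ π j ∉ A})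
    (hg : DependsOn g {j | j ∉ A}) (hG : DependsOn G {j | π j ∉ A}) :
    ‖𝔼 x ∈ Fintype.piFinset D, (w x : ℂ) * (g x * G x)‖ ^ 2 ≤
      (𝔼 x ∈ Fintype.piFinset D, w x) *
        (𝔼 x ∈ Fintype.piFinset D, (w x : ℂ) * (G x * conj (G (A.piecewise (x ∘ π) x)))).re := by
  have hcond : 𝔼 x ∈ Fintype.piFinset D, (w x : ℂ) * (g x * G x)
      = 𝔼 x ∈ Fintype.piFinset D, (w x : ℂ) * (g x * fiberExpect D A G x) := by
    simp only [← mul_assoc]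
    refine (expect_mul_fiberExpect D A (fun x t => ?_) G).symm
    rw [hw fun j hj => piecewise_eq_of_notMem _ _ _ hj.1,
      hg fun j hj => piecewise_eq_of_notMem _ _ _ hj]
  rw [hcond, ← expect_mul_norm_sq_fiberExpect D hπ hD hw hG, Complex.ofReal_re]
  calc
    _ ≤ (𝔼 x ∈ Fintype.piFinset D, w x) *
        𝔼 x ∈ Fintype.piFinset D, w x * ‖g x * fiberExpect D A G x‖ ^ 2 :=
      norm_sq_expect_mul_le _ hw₀ _
    _ ≤ _ := by
      gcongr with x
      · exact expect_nonneg fun x _ => hw₀ x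
      · exact hw₀ x
      · rw [norm_mul]
        exact mul_le_of_le_one_left (norm_nonneg _) (hg₁ x)

end Averages

section CharacterSums

variable {N : ℕ} [NeZero N]

theorem sum_stdAddChar_comp {G : Type*} [AddCommGroup G] [Fintype G]
    (f : G →+ ZMod N) [Decidable (f = 0)] :
    ∑ x, ZMod.stdAddChar (f x) = if f = 0 then (Fintype.card G : ℂ) else 0 := by
  have hzero : (ZMod.stdAddChar (N := N)).compAddMonoidHom f = 0 ↔ f = 0 := by
    simp only [DFunLike.ext_iff, AddChar.compAddMonoidHom_apply,
      AddChar.zero_apply, AddMonoidHom.zero_apply,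
      ← ZMod.injective_stdAddChar.eq_iff (b := (0 : ZMod N)), AddChar.map_zero_eq_one]
  simpa only [AddChar.compAddMonoidHom_apply, hzero] using
    AddChar.sum_eq_ite ((ZMod.stdAddChar (N := N)).compAddMonoidHom f)

theorem norm_sq_sum_stdAddChar_le {G : Type*} [AddCommGroup G] [Fintype G]
    {Q : G → ZMod N} {b : G → G →+ ZMod N} [DecidablePred (b · = 0)]
    (hQ : ∀ x h, Q (x + h) = Q x + Q h + b h x) :
    ‖∑ x, ZMod.stdAddChar (Q x)‖ ^ 2 ≤ (Fintype.card G : ℝ) * #{h | b h = 0} := by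
  have hexpand : ((‖∑ x, ZMod.stdAddChar (Q x)‖ ^ 2 : ℝ) : ℂ)
      = ∑ h, ZMod.stdAddChar (Q h) * ∑ x, ZMod.stdAddChar (b h x) := by
    push_cast
    rw [← Complex.conj_mul', map_sum, sum_mul_sum]
    simp_rw [mul_sum]
    rw [sum_comm (f := fun h x => ZMod.stdAddChar (Q h) * ZMod.stdAddChar (b h x))]
    refine sum_congr rfl fun x _ => ?_
    rw [← Equiv.sum_comp (Equiv.addLeft x)]
    refine sum_congr rfl fun h _ => ?_
    rw [Equiv.coe_addLeft, hQ, ← AddChar.map_neg_eq_conj, ← AddChar.map_add_eq_mul,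
      ← AddChar.map_add_eq_mul, add_assoc, neg_add_cancel_left]
  calc
    _ = ‖∑ h, ZMod.stdAddChar (Q h) * ∑ x, ZMod.stdAddChar (b h x)‖ := by
      rw [← hexpand, Complex.norm_real, Real.norm_of_nonneg (by positivity)]
    _ ≤ ∑ h, ‖∑ x, ZMod.stdAddChar (b h x)‖ :=
      norm_sum_le_of_le _ fun h _ => by rw [norm_mul, AddChar.norm_apply, one_mul]
    _ = ∑ h with b h = 0, (Fintype.card G : ℝ) := by
      rw [sum_filter]
      refine sum_congr rfl fun h _ => ?_
      rw [sum_stdAddChar_comp]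
      split_ifs <;> simp
    _ = _ := by rw [sum_const, nsmul_eq_mul, mul_comm]

variable {Ω C : Type*} [Fintype Ω] [Fintype C]

theorem sum_stdAddChar_dotProduct [DecidableEq C] (u : C → ZMod N) :
    ∑ c : C → ZMod N, ZMod.stdAddChar (c ⬝ᵥ u)
      = if u = 0 then (N : ℂ) ^ Fintype.card C else 0 := by
  simpa [dotProduct_comm, ← map_eq_zero_iff (dotProductEquiv (ZMod N) C).toAddMonoidHom
    (dotProductEquiv (ZMod N) C).injective, DFunLike.ext_iff] using
    sum_stdAddChar_comp (dotProductEquiv (ZMod N) C u).toAddMonoidHom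

theorem card_fiber_mul_pow [DecidableEq C] (φ : Ω → C → ZMod N) (v : C → ZMod N) :
    (#{x | φ x = v} * N ^ Fintype.card C : ℂ)
      = ∑ c : C → ZMod N, ZMod.stdAddChar (-(c ⬝ᵥ v)) * ∑ x, ZMod.stdAddChar (c ⬝ᵥ φ x) := by
  simp_rw [mul_sum, ← AddChar.map_add_eq_mul, neg_add_eq_sub, ← dotProduct_sub]
  rw [sum_comm]
  simp_rw [sum_stdAddChar_dotProduct, sub_eq_zero]
  rw [← sum_filter, sum_const, nsmul_eq_mul]

theorem abs_card_fiber_mul_pow_sub_card_le {φ : Ω → C → ZMod N} {η : ℝ} (hη₀ : 0 ≤ η)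
    (hη : ∀ c : C → ZMod N, c ≠ 0 → ‖∑ x, ZMod.stdAddChar (c ⬝ᵥ φ x)‖ ≤ η) (v : C → ZMod N) :
    |(#{x | φ x = v} : ℝ) * (N : ℝ) ^ Fintype.card C - Fintype.card Ω|
      ≤ (N : ℝ) ^ Fintype.card C * η := by
  classical
  have hsplit : (((#{x | φ x = v} : ℝ) * (N : ℝ) ^ Fintype.card C - Fintype.card Ω : ℝ) : ℂ)
      = ∑ c ∈ univ.erase 0,
          ZMod.stdAddChar (-(c ⬝ᵥ v)) * ∑ x, ZMod.stdAddChar (c ⬝ᵥ φ x) := by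
    push_cast
    rw [card_fiber_mul_pow, ← add_sum_erase _ _ (mem_univ 0)]
    simp
  calc
    _ = ‖∑ c ∈ univ.erase 0,
          ZMod.stdAddChar (-(c ⬝ᵥ v)) * ∑ x, ZMod.stdAddChar (c ⬝ᵥ φ x)‖ := by
      rw [← hsplit, Complex.norm_real, Real.norm_eq_abs]
    _ ≤ ∑ _c ∈ univ.erase (0 : C → ZMod N), η := norm_sum_le_of_le _ fun c hc => by
      rw [norm_mul, AddChar.norm_apply, one_mul]
      exact hη c (ne_of_mem_erase hc)
    _ ≤ ∑ _c : C → ZMod N, η :=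
      sum_le_sum_of_subset_of_nonneg (erase_subset _ _) fun _ _ _ => hη₀
    _ = _ := by simp [ZMod.card]

end CharacterSums

section QuadraticPhase

theorem dotProduct_mulVec_comm_of_isSymm {R ι : Type*} [CommSemiring R] [Fintype ι]
    {A : Matrix ι ι R} (hA : A.IsSymm) (x y : ι → R) : x ⬝ᵥ A *ᵥ y = y ⬝ᵥ A *ᵥ x := by
  rw [Matrix.dotProduct_mulVec, ← Matrix.mulVec_transpose, hA.eq, dotProduct_comm]

variable {R ι J P S : Type*} [CommRing R] [Fintype ι] [Fintype P] [Fintype S]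

/-- The additive form `x ↦ ∑ k, x_{a(k)} · g_k` on tuples of vectors. -/
def linearForm (a : P → J) (g : P → ι → R) : (J → ι → R) →+ R where
  toFun x := ∑ k, x (a k) ⬝ᵥ g k
  map_zero' := by simp
  map_add' x y := by simp only [Pi.add_apply, add_dotProduct, sum_add_distrib]

theorem linearForm_eq_zero {a : P → J} (ha : Function.Injective a) {g : P → ι → R}
    (h : linearForm a g = 0) : g = 0 := by
  classical
  funext k
  refine dotProduct_eq_zero _ fun v => ?_
  have hv : ∑ k', (Pi.single (a k) v : J → ι → R) (a k') ⬝ᵥ g k' = 0 :=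
    DFunLike.congr_fun h (Pi.single (a k) v : J → ι → R)
  rw [sum_eq_single k (fun k' _ hk' => ?_) (by simp)] at hv
  · rwa [Pi.single_eq_same, dotProduct_comm] at hv
  · rw [Pi.single_eq_of_ne (ha.ne hk'), zero_dotProduct]

variable [DecidableEq J]

/-- The vector paired with `x_j` in the polarization
`Q(x + h) - Q(x) - Q(h) = ∑ j, x_j · (polarCoeff A b j h)` of the quadratic form
`Q(x) = ∑ s, x_{b(s)₁}ᵀ A_s x_{b(s)₂}`. -/
def polarCoeff (A : S → Matrix ι ι R) (b : S → J × J) (j : J) : (J → ι → R) →ₗ[R] ι → R :=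
  ∑ s, ((if (b s).1 = j then (A s).mulVecLin ∘ₗ LinearMap.proj (b s).2 else 0) +
    if (b s).2 = j then (A s).mulVecLin ∘ₗ LinearMap.proj (b s).1 else 0)

theorem polarCoeff_apply (A : S → Matrix ι ι R) (b : S → J × J) (j : J) (h : J → ι → R) :
    polarCoeff A b j h = ∑ s, ((if (b s).1 = j then A s *ᵥ h (b s).2 else 0) +
      if (b s).2 = j then A s *ᵥ h (b s).1 else 0) := by
  rw [polarCoeff, LinearMap.sum_apply]
  refine sum_congr rfl fun s _ => ?_
  rw [LinearMap.add_apply]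
  split_ifs <;> rfl

theorem polarCoeff_single (A : S → Matrix ι ι R) {b : S → J × J}
    (hb : Function.Injective fun s => s((b s).1, (b s).2)) (s : S) (v : ι → R) :
    polarCoeff A b (b s).1 (Pi.single (b s).2 v)
      = (if (b s).1 = (b s).2 then 2 else 1 : R) • A s *ᵥ v := by
  rw [polarCoeff_apply, sum_eq_single s (fun s' _ hs' => ?_) (by simp)]
  · by_cases hd : (b s).1 = (b s).2
    · simp [hd, two_smul]
    · simp [hd, Ne.symm hd]
  have hne : ¬((b s').1 = (b s).1 ∧ (b s').2 = (b s).2) := fun h =>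
    hs' (hb (Sym2.eq_iff.2 (Or.inl h)))
  have hne' : ¬((b s').2 = (b s).1 ∧ (b s').1 = (b s).2) := fun h =>
    hs' (hb (Sym2.eq_iff.2 (Or.inr h.symm)))
  rw [ite_eq_right_iff.2 fun h => ?_, ite_eq_right_iff.2 fun h => ?_, add_zero]
  · rw [Pi.single_eq_of_ne fun h' => hne' ⟨h, h'⟩, Matrix.mulVec_zero]
  · rw [Pi.single_eq_of_ne fun h' => hne ⟨h, h'⟩, Matrix.mulVec_zero]

theorem rank_le_finrank_range_polarCoeff [Finite J] {k : Type*} [Field k] (hk : (2 : k) ≠ 0)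
    (A : S → Matrix ι ι k) {b : S → J × J}
    (hb : Function.Injective fun s => s((b s).1, (b s).2)) (s : S) :
    (A s).rank ≤ Module.finrank k (LinearMap.range (polarCoeff A b (b s).1)) := by
  refine Submodule.finrank_mono ?_
  rintro _ ⟨v, rfl⟩
  set c : k := if (b s).1 = (b s).2 then 2 else 1
  have hc : c ≠ 0 := by
    simp only [c]
    split_ifs
    exacts [hk, one_ne_zero]
  refine ⟨c⁻¹ • Pi.single (b s).2 v, ?_⟩
  rw [map_smul, polarCoeff_single A hb, smul_smul, inv_mul_cancel₀ hc, one_smul,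
    Matrix.mulVecLin_apply]

theorem sum_dotProduct_mulVec_add [Fintype J] {A : S → Matrix ι ι R} (hA : ∀ s, (A s).IsSymm)
    (b : S → J × J) (x h : J → ι → R) :
    ∑ s, (x + h) (b s).1 ⬝ᵥ A s *ᵥ (x + h) (b s).2
      = ∑ s, x (b s).1 ⬝ᵥ A s *ᵥ x (b s).2 + ∑ s, h (b s).1 ⬝ᵥ A s *ᵥ h (b s).2
        + linearForm id (fun j => polarCoeff A b j h) x := by
  have hpolar : linearForm id (fun j => polarCoeff A b j h) x
      = ∑ s, (x (b s).1 ⬝ᵥ A s *ᵥ h (b s).2 + x (b s).2 ⬝ᵥ A s *ᵥ h (b s).1) := by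
    change ∑ j, x j ⬝ᵥ polarCoeff A b j h = _
    simp_rw [polarCoeff_apply, dotProduct_sum, dotProduct_add]
    rw [sum_comm]
    refine sum_congr rfl fun s _ => ?_
    rw [sum_add_distrib]
    congr 1 <;> · rw [Finset.sum_eq_single_of_mem _ (mem_univ _) fun j _ hj => ?_, if_pos rfl]
                  rw [if_neg hj.symm, dotProduct_zero]
  rw [hpolar, ← sum_add_distrib, ← sum_add_distrib]
  refine sum_congr rfl fun s _ => ?_
  rw [dotProduct_mulVec_comm_of_isSymm (hA s) (x (b s).2)]
  simp only [Pi.add_apply, add_dotProduct, Matrix.mulVec_add, dotProduct_add]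
  ring

end QuadraticPhase

section PhaseBound

theorem card_ker_mul_pow_finrank_range {k V W : Type*} [Field k] [Fintype k] [AddCommGroup V]
    [Module k V] [Fintype V] [AddCommGroup W] [Module k W] [DecidableEq W] (L : V →ₗ[k] W) :
    #{x | L x = 0} * Fintype.card k ^ Module.finrank k (LinearMap.range L) = Fintype.card V := by
  have hker : #{x | L x = 0} = Fintype.card k ^ Module.finrank k (LinearMap.ker L) := by
    rw [← Nat.card_eq_fintype_card, ← Module.natCard_eq_pow_finrank, ← Fintype.card_subtype,
      ← Nat.card_eq_fintype_card]
    rfl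
  rw [hker, ← pow_add, add_comm, LinearMap.finrank_range_add_finrank_ker,
    ← Module.card_eq_pow_finrank]

theorem two_ne_zero_of_two_lt {p : ℕ} (hp : 2 < p) : (2 : ZMod p) ≠ 0 := fun h => by
  have hdvd := (ZMod.natCast_eq_zero_iff 2 p).1 (mod_cast h)
  exact hp.not_ge (Nat.le_of_dvd two_pos hdvd)

variable {p : ℕ} [Fact p.Prime] {ι J S : Type*} [Fintype ι] [DecidableEq ι] [Fintype J]
  [DecidableEq J] [Fintype S]

theorem norm_sum_stdAddChar_quadratic_mul_pow_le (hp : 2 < p) (f : (J → ι → ZMod p) →+ ZMod p)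
    {A : S → Matrix ι ι (ZMod p)} (hA : ∀ s, (A s).IsSymm) {b : S → J × J}
    (hb : Function.Injective fun s => s((b s).1, (b s).2)) {t : ℕ} {s : S}
    (ht : 2 * t ≤ (A s).rank) :
    ‖∑ x : J → ι → ZMod p, ZMod.stdAddChar
        (f x + ∑ s, x (b s).1 ⬝ᵥ A s *ᵥ x (b s).2)‖ * (p : ℝ) ^ t
      ≤ Fintype.card (J → ι → ZMod p) := by
  set β : (J → ι → ZMod p) → (J → ι → ZMod p) →+ ZMod p :=
    fun h => linearForm id fun j => polarCoeff A b j h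
  have hweyl := norm_sq_sum_stdAddChar_le (b := β)
    (Q := fun x : J → ι → ZMod p => f x + ∑ s, x (b s).1 ⬝ᵥ A s *ᵥ x (b s).2) fun x h => by
      rw [map_add, sum_dotProduct_mulVec_add hA]
      ring
  have hsubset : #{h | β h = 0} ≤ #{h | polarCoeff A b (b s).1 h = 0} :=
    card_le_card fun h hh => by
      rw [mem_filter] at hh ⊢
      exact ⟨hh.1, congrFun (linearForm_eq_zero Function.injective_id hh.2) (b s).1⟩
  have hker : (#{h | β h = 0} : ℝ) * p ^ (2 * t) ≤ Fintype.card (J → ι → ZMod p) := by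
    rw [← card_ker_mul_pow_finrank_range (polarCoeff A b (b s).1), ZMod.card]
    exact_mod_cast Nat.mul_le_mul hsubset (Nat.pow_le_pow_right (by lia)
      (ht.trans (rank_le_finrank_range_polarCoeff (two_ne_zero_of_two_lt hp) A hb s)))
  refine le_of_sq_le_sq ?_ (Nat.cast_nonneg _)
  calc
    _ = ‖∑ x : J → ι → ZMod p, ZMod.stdAddChar
        (f x + ∑ s, x (b s).1 ⬝ᵥ A s *ᵥ x (b s).2)‖ ^ 2 * (p : ℝ) ^ (2 * t) := by ring
    _ ≤ Fintype.card (J → ι → ZMod p) * #{h | β h = 0} * (p : ℝ) ^ (2 * t) := by gcongr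
    _ ≤ Fintype.card (J → ι → ZMod p) * Fintype.card (J → ι → ZMod p) := by
      rw [mul_assoc]
      gcongr
    _ = _ := (sq _).symm

end PhaseBound

section Constraints

theorem card_pi_vec (p n : ℕ) [NeZero p] (J : Type*) [Fintype J] [DecidableEq J] :
    (Fintype.card (J → Vec p n) : ℝ) = (p : ℝ) ^ (n * Fintype.card J) := by
  simp [ZMod.card, pow_mul]

namespace QuadraticFactor

variable {p n l q : ℕ} {J P S : Type*}

/-- The values at a tuple of vectors of the linear forms of `B` on the vectors indexed by `a`
and of the bilinear forms of `B` on the pairs indexed by `b`. Atoms correspond to diagonal pairs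
and bilinear level sets to off-diagonal ones. -/
def constraintMap (B : QuadraticFactor p n l q) (a : P → J) (b : S → J × J) (x : J → Vec p n) :
    (P × Fin l) ⊕ (S × Fin q) → ZMod p :=
  Sum.elim (fun k => x (a k.1) ⬝ᵥ B.r k.2) fun s => x (b s.1).1 ⬝ᵥ B.M s.2 *ᵥ x (b s.1).2

theorem isSymm_sum_smul (B : QuadraticFactor p n l q) (c : Fin q → ZMod p) :
    (∑ j, c j • B.M j).IsSymm := by
  rw [Matrix.IsSymm, Matrix.transpose_sum]
  exact sum_congr rfl fun j _ => by rw [Matrix.transpose_smul, (B.isSymm j).eq]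

variable [Fintype P] [Fintype S]

theorem dotProduct_constraintMap (B : QuadraticFactor p n l q) (a : P → J) (b : S → J × J)
    (c : (P × Fin l) ⊕ (S × Fin q) → ZMod p) (x : J → Vec p n) :
    c ⬝ᵥ B.constraintMap a b x
      = linearForm a (fun k => ∑ i, c (Sum.inl (k, i)) • B.r i) x
        + ∑ s, x (b s).1 ⬝ᵥ (∑ j, c (Sum.inr (s, j)) • B.M j) *ᵥ x (b s).2 := by
  change _ = ∑ k, x (a k) ⬝ᵥ ∑ i, c (Sum.inl (k, i)) • B.r i + _
  simp only [dotProduct_sum, dotProduct_smul, Matrix.sum_mulVec, Matrix.smul_mulVec]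
  rw [dotProduct, Fintype.sum_sum_type, Fintype.sum_prod_type, Fintype.sum_prod_type]
  rfl

variable [Fact p.Prime] [Fintype J] [DecidableEq J] (B : QuadraticFactor p n l q) {t : ℕ}

theorem norm_sum_stdAddChar_constraintMap_le (hp : 2 < p)
    (hB : ∀ c : Fin q → ZMod p, c ≠ 0 → 2 * t ≤ (∑ j, c j • B.M j).rank) {a : P → J}
    (ha : Function.Injective a) {b : S → J × J}
    (hb : Function.Injective fun s => s((b s).1, (b s).2))
    {c : (P × Fin l) ⊕ (S × Fin q) → ZMod p} (hc : c ≠ 0) :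
    ‖∑ x, ZMod.stdAddChar (c ⬝ᵥ B.constraintMap a b x)‖
      ≤ (p : ℝ) ^ (n * Fintype.card J) / (p : ℝ) ^ t := by
  have : (0 : ℝ) < p := mod_cast Nat.zero_lt_of_lt hp
  simp_rw [dotProduct_constraintMap]
  by_cases hquad : ∃ s, (fun j => c (Sum.inr (s, j))) ≠ 0
  · obtain ⟨s, hs⟩ := hquad
    rw [le_div_iff₀ (by positivity), ← card_pi_vec]
    exact norm_sum_stdAddChar_quadratic_mul_pow_le hp _ (fun s => B.isSymm_sum_smul _) hb
      (hB _ hs)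
  push Not at hquad
  have hquad' (s : S) : ∑ j, c (Sum.inr (s, j)) • B.M j = 0 :=
    sum_eq_zero fun j _ => by rw [congrFun (hquad s) j, Pi.zero_apply, zero_smul]
  have hlin : linearForm a (fun k => ∑ i, c (Sum.inl (k, i)) • B.r i) ≠ 0 := fun h => hc <| by
    ext (⟨k, i⟩ | ⟨s, j⟩)
    · exact Fintype.linearIndependent_iff.1 B.linearIndependent _
        (congrFun (linearForm_eq_zero ha h) k) i
    · exact congrFun (hquad s) j
  classical
  simp only [hquad', Matrix.zero_mulVec, dotProduct_zero, sum_const_zero, add_zero]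
  rw [sum_stdAddChar_comp, if_neg hlin, norm_zero]
  positivity

theorem abs_card_constraintMap_mul_div_sub_one_le (hp : 2 < p) (s : ℕ)
    (hB : ∀ c : Fin q → ZMod p, c ≠ 0 →
      2 * (Fintype.card P * l + Fintype.card S * q + s) ≤ (∑ j, c j • B.M j).rank) {a : P → J}
    (ha : Function.Injective a) {b : S → J × J}
    (hb : Function.Injective fun s => s((b s).1, (b s).2))
    (w : (P × Fin l) ⊕ (S × Fin q) → ZMod p) :
    |(#{x | B.constraintMap a b x = w} : ℝ) * (p : ℝ) ^ (Fintype.card P * l + Fintype.card S * q)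
        / (p : ℝ) ^ (n * Fintype.card J) - 1| ≤ 1 / (p : ℝ) ^ s := by
  have : (0 : ℝ) < p := mod_cast Nat.zero_lt_of_lt hp
  have hR : 0 < (p : ℝ) ^ (n * Fintype.card J) := by positivity
  have hcount := abs_card_fiber_mul_pow_sub_card_le (φ := B.constraintMap a b) (by positivity)
    (fun c hc => B.norm_sum_stdAddChar_constraintMap_le hp hB ha hb hc) w
  simp only [Fintype.card_sum, Fintype.card_prod, Fintype.card_fin, card_pi_vec] at hcount
  rw [div_sub_one hR.ne', abs_div, abs_of_pos hR, div_le_iff₀ hR]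
  refine hcount.trans_eq ?_
  rw [pow_add _ _ s]
  field_simp

end QuadraticFactor

end Constraints

section Ratios

theorem abs_sub_one_le_two_mul {y t : ℝ} (hy : y ≤ 1 / 2) (ht₀ : 1 - y ≤ t)
    (ht₁ : t ≤ (1 - y)⁻¹) : |t - 1| ≤ 2 * y := by
  rw [← one_div, le_div_iff₀ (by linarith)] at ht₁
  rw [abs_le]
  constructor <;> nlinarith

theorem mem_Icc_inv_of_abs_sub_one_le {η x : ℝ} (hη : η < 1) (hx : |x - 1| ≤ η) :
    x ∈ Set.Icc (1 - η) (1 - η)⁻¹ := by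
  have hx' := abs_le.1 hx
  refine ⟨by linarith, ?_⟩
  rw [← one_div, le_div_iff₀ (by linarith)]
  nlinarith

theorem prod_mem_Icc_pow {ι : Type*} {s : Finset ι} {f : ι → ℝ} {r R : ℝ} (hr : 0 ≤ r)
    (hf : ∀ i ∈ s, f i ∈ Set.Icc r R) : ∏ i ∈ s, f i ∈ Set.Icc (r ^ #s) (R ^ #s) := by
  rw [← prod_const, ← prod_const]
  exact ⟨prod_le_prod (fun _ _ => hr) fun i hi => (hf i hi).1,
    prod_le_prod (fun i hi => hr.trans (hf i hi).1) fun i hi => (hf i hi).2⟩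

theorem abs_div_mul_prod_sub_one_le {ι : Type*} (s : Finset ι) {η a b : ℝ} {f : ι → ℝ}
    (hs : ((#s : ℝ) + 2) * η ≤ 1 / 2) (ha : |a - 1| ≤ η) (hb : |b - 1| ≤ η)
    (hf : ∀ i ∈ s, |f i - 1| ≤ η) :
    |a / (b * ∏ i ∈ s, f i) - 1| ≤ 2 * (((#s : ℝ) + 2) * η) := by
  have hη₀ : 0 ≤ η := (abs_nonneg _).trans ha
  have hη₁ : η ≤ 1 / 4 := by nlinarith [mul_nonneg (Nat.cast_nonneg (α := ℝ) #s) hη₀]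
  set r : ℝ := 1 - η
  have hr : 0 < r := by linarith
  have hmem {x : ℝ} (hx : |x - 1| ≤ η) : x ∈ Set.Icc r r⁻¹ :=
    mem_Icc_inv_of_abs_sub_one_le (by linarith) hx
  obtain ⟨hprod₀, hprod₁⟩ := prod_mem_Icc_pow hr.le fun i hi => hmem (hf i hi)
  obtain ⟨ha₀, ha₁⟩ := hmem ha
  obtain ⟨hb₀, hb₁⟩ := hmem hb
  have hbern : 1 - ((#s : ℝ) + 2) * η ≤ r ^ (#s + 2) := by
    have h := one_add_mul_le_pow (a := -η) (by linarith) (#s + 2)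
    rw [← sub_eq_add_neg] at h
    push_cast at h
    linarith
  have hprod : 0 < ∏ i ∈ s, f i := (by positivity : 0 < r ^ #s).trans_le hprod₀
  have ha : 0 ≤ a := hr.le.trans ha₀
  have hb : 0 < b := hr.trans_le hb₀
  refine abs_sub_one_le_two_mul hs (hbern.trans ?_) (le_trans ?_ (inv_anti₀ (by linarith) hbern))
  · calc
      r ^ (#s + 2) = r / (r⁻¹ * r⁻¹ ^ #s) := by
        rw [inv_pow]
        field_simp
        ring
      _ ≤ _ := by gcongr
  · calc
      a / (b * ∏ i ∈ s, f i) ≤ r⁻¹ / (r * r ^ #s) := by gcongr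
      _ = _ := by
        field_simp
        ring

end Ratios

section CharacteristicMeasures

namespace QuadraticFactor

variable {p n l q : ℕ} [Fact p.Prime]

theorem abs_card_beta_mul_div_sub_one_le (B : QuadraticFactor p n l q) (hp : 2 < p) (s : ℕ)
    (hB : ∀ c : Fin q → ZMod p, c ≠ 0 → 2 * (q + s) ≤ (∑ j, c j • B.M j).rank)
    (d : Fin q → ZMod p) :
    |(#(B.beta d) : ℝ) * (p : ℝ) ^ q / (p : ℝ) ^ (2 * n) - 1| ≤ 1 / (p : ℝ) ^ s := by
  let b : Unit → Fin 2 × Fin 2 := fun _ => (0, 1)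
  have hcard : #{x | B.constraintMap Empty.elim b x = Sum.elim (·.1.elim) fun s => d s.2}
      = #(B.beta d) := by
    refine card_equiv (finTwoArrowEquiv _) fun x => ?_
    simp [constraintMap, beta, funext_iff, b]
  have hcount := B.abs_card_constraintMap_mul_div_sub_one_le hp s (P := Empty) (by simpa using hB)
    (a := Empty.elim) (fun x => x.elim) (b := b) (Function.injective_of_subsingleton _)
    (Sum.elim (·.1.elim) fun s => d s.2)
  simpa [hcard, mul_comm n] using hcount

variable {J : Type*} [Fintype J] [DecidableEq J]

theorem abs_card_tuples_mul_div_sub_one_le (B : QuadraticFactor p n l q) (hp : 2 < p) (s : ℕ)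
    (a : J → AtomLabel p l q) {S : Finset (J × J)} (hS : ∀ z ∈ S, z.swap ∉ S)
    (hB : ∀ c : Fin q → ZMod p, c ≠ 0 →
      2 * ((l + q) * Fintype.card J + q * #S + s) ≤ (∑ j, c j • B.M j).rank)
    (d : J × J → Fin q → ZMod p) :
    |(#{x ∈ Fintype.piFinset fun j => B.atom (a j) | ∀ z ∈ S, (x z.1, x z.2) ∈ B.beta (d z)} : ℝ)
        * (p : ℝ) ^ ((l + q) * Fintype.card J + q * #S) / (p : ℝ) ^ (n * Fintype.card J) - 1|
      ≤ 1 / (p : ℝ) ^ s := by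
  let b : J ⊕ S → J × J := Sum.elim (fun j => (j, j)) Subtype.val
  have hb : Function.Injective fun t => s((b t).1, (b t).2) := by
    rintro (j | ⟨z, hz⟩) (j' | ⟨z', hz'⟩) h
    · simpa [b] using h
    · obtain rfl : z' = (j, j) := by simpa [b, Prod.ext_iff, eq_comm, and_comm] using h
      exact absurd hz' (hS _ hz')
    · obtain rfl : z = (j', j') := by simpa [b, Prod.ext_iff] using h
      exact absurd hz (hS _ hz)
    · have hzz' : z = z' ∨ z = z'.swap := by simpa [b, Prod.ext_iff] using h
      obtain rfl | rfl := hzz'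
      · rfl
      · exact absurd hz (hS _ hz')
  have hdim : (l + q) * Fintype.card J + q * #S
      = Fintype.card J * l + Fintype.card (J ⊕ S) * q := by
    rw [Fintype.card_sum, Fintype.card_coe]
    ring
  rw [hdim] at hB ⊢
  convert B.abs_card_constraintMap_mul_div_sub_one_le hp s hB Function.injective_id hb
    (Sum.elim (fun k => (a k.1).1 k.2) fun t =>
      Sum.elim (fun j => (a j).2) (fun z : S => d z) t.1 t.2) using 6
  congr 1
  ext x
  simp only [mem_filter, mem_univ, true_and, Fintype.mem_piFinset, atom, beta, constraintMap,
    funext_iff, Sum.forall, Prod.forall, Subtype.forall, Sum.elim_inl, Sum.elim_inr, id, b,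
    forall_and, and_assoc]

theorem prod_mu_eq (B : QuadraticFactor p n l q) (S : Finset (J × J)) (d : J × J → Fin q → ZMod p)
    (x : J → Vec p n) :
    ∏ z ∈ S, B.mu (d z) (x z.1) (x z.2) = if ∀ z ∈ S, (x z.1, x z.2) ∈ B.beta (d z) then
      ∏ z ∈ S, (p : ℝ) ^ (2 * n) / #(B.beta (d z)) else 0 := by
  simp only [mu, Fintype.card_pi_const, ZMod.card, Nat.cast_pow, ← pow_mul, mul_comm n]
  convert prod_ite_zero

theorem expect_prod_mu_eq (B : QuadraticFactor p n l q) (D : Finset (J → Vec p n))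
    (S : Finset (J × J)) (d : J × J → Fin q → ZMod p) :
    𝔼 x ∈ D, ∏ z ∈ S, B.mu (d z) (x z.1) (x z.2)
      = #{x ∈ D | ∀ z ∈ S, (x z.1, x z.2) ∈ B.beta (d z)} *
          (∏ z ∈ S, (p : ℝ) ^ (2 * n) / #(B.beta (d z))) / #D := by
  simp_rw [prod_mu_eq]
  rw [expect_eq_sum_div_card, ← sum_filter, sum_const, nsmul_eq_mul]

theorem abs_expect_prod_mu_sub_one_le (B : QuadraticFactor p n l q) (hp : 2 < p) {K s : ℕ}
    (hB : ∀ c : Fin q → ZMod p, c ≠ 0 → 2 * (K * (l + q) + s) ≤ (∑ j, c j • B.M j).rank)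
    (a : J → AtomLabel p l q) {S : Finset (J × J)} (hS : ∀ z ∈ S, z.swap ∉ S) (hK₀ : 0 < K)
    (hK : Fintype.card J + #S ≤ K) (d : J × J → Fin q → ZMod p) {δ : ℝ} (hδ : δ ≤ 1)
    (hs : 2 * ((K : ℝ) + 2) / 3 ^ s ≤ δ) :
    |(𝔼 x ∈ Fintype.piFinset fun j => B.atom (a j), ∏ z ∈ S, B.mu (d z) (x z.1) (x z.2)) - 1|
      ≤ δ := by
  have : (0 : ℝ) < p := mod_cast Nat.zero_lt_of_lt hp
  have hη : 2 * (((#S : ℝ) + 2) * (1 / (p : ℝ) ^ s)) ≤ δ := by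
    refine le_trans ?_ hs
    rw [mul_one_div, mul_div_assoc]
    gcongr
    · lia
    · exact_mod_cast hp
  have hmono {t : ℕ} (ht : t ≤ K * (l + q)) (c : Fin q → ZMod p) (hc : c ≠ 0) :
      2 * (t + s) ≤ (∑ j, c j • B.M j).rank := le_trans (by lia) (hB c hc)
  have htuples := B.abs_card_tuples_mul_div_sub_one_le hp s a hS (hmono (by nlinarith)) d
  have hatoms := B.abs_card_tuples_mul_div_sub_one_le hp s a (S := ∅) (by simp)
    (hmono (by rw [card_empty]; nlinarith)) d
  have hbeta (z : J × J) :=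
    B.abs_card_beta_mul_div_sub_one_le hp s (hmono (by nlinarith)) (d z)
  have hpos {x c : ℝ} (hx : |x * c - 1| ≤ 1 / (p : ℝ) ^ s) : x ≠ 0 := by
    rintro rfl
    rw [zero_mul, zero_sub, abs_neg, abs_one] at hx
    nlinarith [Nat.cast_nonneg (α := ℝ) #S]
  simp only [notMem_empty, IsEmpty.forall_iff, implies_true, filter_true, card_empty, mul_zero,
    add_zero] at hatoms
  refine le_trans (le_of_eq ?_) ((abs_div_mul_prod_sub_one_le S (by linarith) htuples hatoms
    fun z _ => hbeta z).trans hη)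
  have hatoms₀ := hpos (mul_div_assoc _ _ (_ : ℝ) ▸ hatoms)
  have hbeta₀ : ∏ z ∈ S, (#(B.beta (d z)) : ℝ) ≠ 0 :=
    prod_ne_zero_iff.2 fun z _ => hpos (mul_div_assoc _ _ (_ : ℝ) ▸ hbeta z)
  simp_rw [expect_prod_mu_eq, prod_div_distrib, prod_mul_distrib, prod_const]
  rw [pow_add, pow_mul (p : ℝ) q]
  field_simp

end QuadraticFactor

end CharacteristicMeasures

section DoubledVertices

variable {I X : Type*}

/-- Exchange of the two copies of a vertex in the doubled vertex set `I × Fin 2`. -/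
def flipCopy (j : I × Fin 2) : I × Fin 2 := (j.1, j.2 + 1)

theorem flipCopy_involutive : Function.Involutive (flipCopy : I × Fin 2 → I × Fin 2) := by
  rintro ⟨i, b⟩
  exact Prod.ext rfl ((by decide : ∀ b : Fin 2, b + 1 + 1 = b) b)

/-- The doubled vertices that are not the second copy of a vertex in `T`. -/
def firstCopies (T : Finset I) : Set (I × Fin 2) := {j | j.1 ∈ T → j.2 = 0}

theorem firstCopies_singleton (a : I) : firstCopies {a} = {j | j ≠ (a, 1)} := by
  have h01 : ∀ b : Fin 2, b ≠ 1 ↔ b = 0 := by decide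
  ext ⟨i, b⟩
  simp [firstCopies, Prod.ext_iff, h01]

variable [DecidableEq I]

/-- Exchange of the two copies of the vertices in `T`. -/
def flipOn (T : Finset I) (j : I × Fin 2) : I × Fin 2 := if j.1 ∈ T then flipCopy j else j

@[simp]
theorem fst_flipOn (T : Finset I) (j : I × Fin 2) : (flipOn T j).1 = j.1 := by
  unfold flipOn flipCopy; split_ifs <;> rfl

theorem flipOn_of_notMem {T : Finset I} {j : I × Fin 2} (h : j.1 ∉ T) : flipOn T j = j :=
  if_neg h

theorem flipOn_involutive (T : Finset I) : Function.Involutive (flipOn T) := by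
  intro j
  by_cases h : j.1 ∈ T
  · have h' : (flipCopy j).1 ∈ T := h
    simp [flipOn, h, h', flipCopy_involutive j]
  · simp [flipOn, h]

theorem flipOn_notMem_firstCopies {T : Finset I} {j : I × Fin 2} (h : j ∈ firstCopies T)
    (hj : j.1 ∈ T) : flipOn T j ∉ firstCopies T := by
  obtain ⟨i, b⟩ := j
  obtain rfl : b = 0 := h hj
  have hi : i ∈ T := hj
  simp [firstCopies, flipOn, flipCopy, hi]

/-- An ordered pair of doubled vertices, lying over a pair of vertices in `I × I`. -/
abbrev DoubledPair (I : Type*) : Type _ := (I × Fin 2) × (I × Fin 2)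

/-- `S` with the two copies of the vertices in `T` exchanged. -/
def flipPairs (T : Finset I) (S : Finset (DoubledPair I)) : Finset (DoubledPair I) :=
  S.image (Prod.map (flipOn T) (flipOn T))

theorem mem_flipPairs {T : Finset I} {S : Finset (DoubledPair I)} {z : DoubledPair I} :
    z ∈ flipPairs T S ↔ (flipOn T z.1, flipOn T z.2) ∈ S := by
  rw [flipPairs, mem_image]
  constructor
  · rintro ⟨y, hy, rfl⟩
    simpa [flipOn_involutive T y.1, flipOn_involutive T y.2] using hy
  · intro h
    exact ⟨_, h, by simp [flipOn_involutive T z.1, flipOn_involutive T z.2]⟩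

/-- The pairs in `S` that lie over pairs of vertices outside `T`. -/
def avoiding (T : Finset I) (S : Finset (DoubledPair I)) : Finset (DoubledPair I) :=
  S.filter fun z => z.1.1 ∉ T ∧ z.2.1 ∉ T

/-- The pairs in `S` that lie over pairs of vertices not both outside `T`. -/
def meeting (T : Finset I) (S : Finset (DoubledPair I)) : Finset (DoubledPair I) :=
  S.filter fun z => ¬ (z.1.1 ∉ T ∧ z.2.1 ∉ T)

theorem avoiding_union_meeting (T : Finset I) (S : Finset (DoubledPair I)) :
    avoiding T S ∪ meeting T S = S :=
  filter_union_filter_not_eq _ S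

theorem disjoint_avoiding_meeting (T : Finset I) (S : Finset (DoubledPair I)) :
    Disjoint (avoiding T S) (meeting T S) :=
  disjoint_filter_filter_not S S _

theorem flipPairs_avoiding (T : Finset I) (S : Finset (DoubledPair I)) :
    flipPairs T (avoiding T S) = avoiding T S := by
  ext z
  simp only [mem_flipPairs, avoiding, mem_filter, fst_flipOn]
  refine and_congr_left fun h => ?_
  rw [flipOn_of_notMem h.1, flipOn_of_notMem h.2]

theorem union_flipPairs_meeting (T : Finset I) (S : Finset (DoubledPair I)) :
    S ∪ flipPairs T (meeting T S) = S ∪ flipPairs T S := by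
  have hflip : flipPairs T S = avoiding T S ∪ flipPairs T (meeting T S) := by
    rw [← flipPairs_avoiding, flipPairs, flipPairs, flipPairs, ← image_union,
      avoiding_union_meeting]
  have hsub : avoiding T S ⊆ S := filter_subset _ S
  rw [hflip, ← union_assoc, union_eq_left.2 hsub]

theorem disjoint_flipPairs_meeting {T : Finset I} {S S' : Finset (DoubledPair I)}
    (hS : (S : Set (DoubledPair I)) ⊆ firstCopies T ×ˢ firstCopies T)
    (hS' : (S' : Set (DoubledPair I)) ⊆ firstCopies T ×ˢ firstCopies T) :
    Disjoint S (flipPairs T (meeting T S')) := by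
  refine disjoint_left.2 fun z hz hz' => ?_
  obtain ⟨hflip, hT⟩ := mem_filter.1 (mem_flipPairs.1 hz')
  by_cases h : z.1.1 ∈ T
  · refine flipOn_notMem_firstCopies (hS' hflip).1 (by simpa using h) ?_
    simpa only [flipOn_involutive T z.1] using (hS hz).1
  · refine flipOn_notMem_firstCopies (hS' hflip).2 (by simpa [h] using hT) ?_
    simpa only [flipOn_involutive T z.2] using (hS hz).2

variable [Fintype I]

/-- The pairs of doubled vertices that lie over a pair in `E` and use the second copies only of
the vertices in `T`. -/
def doubledEdges (E : Finset (I × I)) (T : Finset I) : Finset (DoubledPair I) :=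
  univ.filter fun z => (z.1.1, z.2.1) ∈ E ∧ (z.1.1 ∉ T → z.1.2 = 0) ∧ (z.2.1 ∉ T → z.2.2 = 0)

theorem mem_doubledEdges {E : Finset (I × I)} {T : Finset I} {z : DoubledPair I} :
    z ∈ doubledEdges E T ↔
      (z.1.1, z.2.1) ∈ E ∧ (z.1.1 ∉ T → z.1.2 = 0) ∧ (z.2.1 ∉ T → z.2.2 = 0) := by
  simp [doubledEdges]

theorem doubledEdges_subset_firstCopies (E : Finset (I × I)) {T T' : Finset I}
    (h : Disjoint T T') :
    (doubledEdges E T : Set (DoubledPair I)) ⊆ firstCopies T' ×ˢ firstCopies T' := fun _ hz =>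
  ⟨fun h' => (mem_doubledEdges.1 hz).2.1 (disjoint_right.1 h h'),
    fun h' => (mem_doubledEdges.1 hz).2.2 (disjoint_right.1 h h')⟩

theorem doubledEdges_insert {E : Finset (I × I)} (hE : ∀ i, (i, i) ∉ E) {T : Finset I} {a : I}
    (ha : a ∉ T) :
    doubledEdges E (insert a T) = doubledEdges E T ∪ flipPairs {a} (doubledEdges E T) := by
  have h01 : ∀ b : Fin 2, b = 0 ∨ b = 1 := by decide
  have : (1 : Fin 2) + 1 = 0 := rfl
  ext ⟨⟨i, b⟩, ⟨j, c⟩⟩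
  simp only [mem_union, mem_flipPairs, mem_doubledEdges, mem_insert, fst_flipOn]
  by_cases hi : i = a <;> by_cases hj : j = a <;> rcases h01 b with rfl | rfl <;>
    rcases h01 c with rfl | rfl <;> simp_all [flipOn, flipCopy]

/-- Replace the first copies of the vertices in `T` by the second copies. -/
def dup (T : Finset I) (x : I × Fin 2 → X) : I × Fin 2 → X :=
  (univ.filter fun j : I × Fin 2 => j.1 ∈ T ∧ j.2 = 0).piecewise (x ∘ flipCopy) x

theorem dup_apply {T : Finset I} {j : I × Fin 2} (h : j ∈ firstCopies T) (x : I × Fin 2 → X) :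
    dup T x j = x (flipOn T j) := by
  by_cases hj : j.1 ∈ T
  · simp [dup, flipOn, hj, h hj]
  · simp [dup, flipOn, hj]

open ComplexConjugate

/-- The product of `G` and its conjugate at the point with the vertices in `T` replaced by their
second copies: the multiplicative derivative that one application of the Cauchy–Schwarz inequality
produces. -/
noncomputable def dupMul (T : Finset I) (G : (I × Fin 2 → X) → ℂ) (x : I × Fin 2 → X) : ℂ :=
  G x * conj (G (dup T x))

theorem dupMul_mul (T : Finset I) (G H : (I × Fin 2 → X) → ℂ) :
    dupMul T (G * H) = dupMul T G * dupMul T H := by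
  ext x
  simp only [dupMul, Pi.mul_apply, map_mul]
  ring

theorem norm_dupMul_le {G : (I × Fin 2 → X) → ℂ} (h : ∀ x, ‖G x‖ ≤ 1) (T : Finset I)
    (x : I × Fin 2 → X) : ‖dupMul T G x‖ ≤ 1 := by
  rw [dupMul, norm_mul, RCLike.norm_conj]
  exact mul_le_one₀ (h x) (norm_nonneg _) (h _)

theorem dependsOn_dupMul {G : (I × Fin 2 → X) → ℂ} {s s' : Set (I × Fin 2)} {T : Finset I}
    (h : DependsOn G s) (hs : s ⊆ s') (hT : ∀ a ∈ T, (a, 0) ∈ s → (a, 1) ∈ s') :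
    DependsOn (dupMul T G) s' := by
  intro x y hxy
  have hG : G x = G y := h fun z hz => hxy z (hs hz)
  have hGdup : G (dup T x) = G (dup T y) := h fun ⟨i, b⟩ hz => by
    by_cases hi : i ∈ T ∧ b = 0
    · obtain ⟨hi, rfl⟩ := hi
      simpa [dup, flipCopy, hi] using hxy _ (hT i hi hz)
    · simpa [dup, hi] using hxy _ (hs hz)
  rw [dupMul, dupMul, hG, hGdup]

end DoubledVertices

section WeightedAverages

variable {I X : Type*} {ν : I × I → X → X → ℝ}

theorem dependsOn_mul {J M : Type*} [Mul M] {G H : (J → X) → M} {s : Set J}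
    (hG : DependsOn G s) (hH : DependsOn H s) : DependsOn (G * H) s := fun _ _ hxy =>
  congrArg₂ (· * ·) (hG hxy) (hH hxy)

/-- The product of the weights of the pairs in `S`, each pair being weighted according to the pair
of vertices that it lies over. -/
def weight (ν : I × I → X → X → ℝ) (S : Finset (DoubledPair I)) (x : I × Fin 2 → X) : ℝ :=
  ∏ z ∈ S, ν (z.1.1, z.2.1) (x z.1) (x z.2)

theorem weight_nonneg (hν : ∀ e x y, 0 ≤ ν e x y) (S : Finset (DoubledPair I))
    (x : I × Fin 2 → X) : 0 ≤ weight ν S x :=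
  prod_nonneg fun _ _ => hν _ _ _

theorem dependsOn_weight {S : Finset (DoubledPair I)} {s : Set (I × Fin 2)}
    (h : (S : Set (DoubledPair I)) ⊆ s ×ˢ s) : DependsOn (weight ν S) s := fun x y hxy =>
  prod_congr rfl fun z hz => by rw [hxy _ (h hz).1, hxy _ (h hz).2]

variable [DecidableEq I]

theorem weight_union {S S' : Finset (DoubledPair I)} (h : Disjoint S S') (x : I × Fin 2 → X) :
    weight ν (S ∪ S') x = weight ν S x * weight ν S' x :=
  prod_union h

theorem weight_eq_avoiding_mul_meeting (T : Finset I) (S : Finset (DoubledPair I))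
    (x : I × Fin 2 → X) :
    weight ν S x = weight ν (avoiding T S) x * weight ν (meeting T S) x := by
  rw [← weight_union (disjoint_avoiding_meeting T S), avoiding_union_meeting]

variable [Fintype I]

theorem weight_dup {T : Finset I} {S : Finset (DoubledPair I)}
    (h : (S : Set (DoubledPair I)) ⊆ firstCopies T ×ˢ firstCopies T) (x : I × Fin 2 → X) :
    weight ν S (dup T x) = weight ν (flipPairs T S) x := by
  rw [weight, weight, flipPairs, prod_image]
  · refine prod_congr rfl fun z hz => ?_
    rw [dup_apply (h hz).1, dup_apply (h hz).2]
    simp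
  · exact ((flipOn_involutive T).injective.prodMap (flipOn_involutive T).injective).injOn

/-- The average of `G` over the points whose coordinates at both copies of `i` lie in `D i`,
weighted by the pairs in `S`. It is not normalised by the total weight, which is close to `1` for
the systems of weights considered here. -/
noncomputable def weightedExpect (ν : I × I → X → X → ℝ) (D : I → Finset X)
    (S : Finset (DoubledPair I)) (G : (I × Fin 2 → X) → ℂ) : ℂ :=
  𝔼 x ∈ Fintype.piFinset fun j : I × Fin 2 => D j.1, (weight ν S x : ℂ) * G x

theorem weightedExpect_congr {D : I → Finset X} {S S' : Finset (DoubledPair I)}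
    {G G' : (I × Fin 2 → X) → ℂ}
    (h : ∀ x, (weight ν S x : ℂ) * G x = (weight ν S' x : ℂ) * G' x) :
    weightedExpect ν D S G = weightedExpect ν D S' G' :=
  expect_congr rfl fun x _ => h x

/-- A system of weights is quasirandom on the pairs in `E` if every product of weights of distinct
pairs over `E`, with up to two copies of each vertex, has average `1` up to `δ`. -/
structure IsQuasirandom (ν : I × I → X → X → ℝ) (D : I → Finset X) (E : Finset (I × I))
    (δ : ℝ) : Prop where
  nonneg : ∀ e x y, 0 ≤ ν e x y
  abs_expect_weight_sub_one_le : ∀ S : Finset (DoubledPair I), (∀ z ∈ S, (z.1.1, z.2.1) ∈ E) →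
    |(𝔼 x ∈ Fintype.piFinset fun j : I × Fin 2 => D j.1, weight ν S x) - 1| ≤ δ

end WeightedAverages

section GeneralizedVonNeumann

variable {I X : Type*} [Fintype I] [DecidableEq I] {ν : I × I → X → X → ℝ}
  {D : I → Finset X} {E : Finset (I × I)} {δ : ℝ}

theorem IsQuasirandom.delta_nonneg (h : IsQuasirandom ν D E δ) : 0 ≤ δ :=
  (abs_nonneg _).trans (h.abs_expect_weight_sub_one_le ∅ (by simp))

theorem IsQuasirandom.norm_sq_weightedExpect_mul_le (h : IsQuasirandom ν D E δ) {T : Finset I}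
    {S : Finset (DoubledPair I)} (hSE : ∀ z ∈ S, (z.1.1, z.2.1) ∈ E)
    (hST : ∀ z ∈ S, z.1.1 ∉ T ∧ z.2.1 ∉ T) {g G : (I × Fin 2 → X) → ℂ} (hg₁ : ∀ x, ‖g x‖ ≤ 1)
    (hg : DependsOn g {j | j.1 ∉ T}) (hG : DependsOn G (firstCopies T)) :
    ‖weightedExpect ν D S (g * G)‖ ^ 2 ≤ (1 + δ) * ‖weightedExpect ν D S (dupMul T G)‖ := by
  set A : Finset (I × Fin 2) := univ.filter fun j => j.1 ∈ T ∧ j.2 = 0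
  have hA (j : I × Fin 2) (hj : j.1 ∉ T) : j ∉ A ∧ flipCopy j ∉ A := by
    simp [A, flipCopy, hj]
  have hflip : firstCopies T ⊆ {j | flipCopy j ∉ A} := by
    rintro ⟨i, b⟩ hj hA
    have hb : i ∈ T ∧ b + 1 = 0 := by simpa [A, flipCopy] using hA
    have hb₀ : b = 0 := hj hb.1
    simp [hb₀] at hb
  have hw : DependsOn (weight ν S) {j | j ∉ A ∧ flipCopy j ∉ A} :=
    dependsOn_weight fun z hz => ⟨hA _ (hST z hz).1, hA _ (hST z hz).2⟩
  refine (norm_sq_expect_le (fun j : I × Fin 2 => D j.1) flipCopy_involutive (fun _ => rfl)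
    (weight_nonneg h.nonneg S) hg₁ hw (hg.mono fun j hj => (hA j hj).1) (hG.mono hflip)).trans ?_
  refine (mul_le_mul_of_nonneg_left (Complex.re_le_norm _)
    (expect_nonneg fun x _ => weight_nonneg h.nonneg S x)).trans
    (mul_le_mul_of_nonneg_right ?_ (norm_nonneg _))
  linarith [(abs_le.1 (h.abs_expect_weight_sub_one_le S hSE)).2]

theorem IsQuasirandom.norm_sq_weightedExpect_mul_le_union_flipPairs (h : IsQuasirandom ν D E δ)
    {T : Finset I} {S : Finset (DoubledPair I)} (hSE : ∀ z ∈ S, (z.1.1, z.2.1) ∈ E)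
    (hST : (S : Set (DoubledPair I)) ⊆ firstCopies T ×ˢ firstCopies T)
    {g G : (I × Fin 2 → X) → ℂ} (hg₁ : ∀ x, ‖g x‖ ≤ 1) (hg : DependsOn g {j | j.1 ∉ T})
    (hG : DependsOn G (firstCopies T)) :
    ‖weightedExpect ν D S (g * G)‖ ^ 2 ≤
      (1 + δ) * ‖weightedExpect ν D (S ∪ flipPairs T S) (dupMul T G)‖ := by
  have hmeet : (meeting T S : Set (DoubledPair I)) ⊆ firstCopies T ×ˢ firstCopies T := fun z hz =>
    hST (mem_filter.1 hz).1
  have hCS := h.norm_sq_weightedExpect_mul_le (S := avoiding T S) (T := T) (g := g)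
    (G := (fun x => (weight ν (meeting T S) x : ℂ)) * G)
    (fun z hz => hSE z (mem_filter.1 hz).1) (fun z hz => (mem_filter.1 hz).2) hg₁ hg
    (dependsOn_mul (fun x y hxy => congrArg _ (dependsOn_weight hmeet hxy)) hG)
  convert hCS using 3
  · refine weightedExpect_congr fun x => ?_
    rw [weight_eq_avoiding_mul_meeting T]
    simp only [Pi.mul_apply]
    push_cast
    ring
  · refine weightedExpect_congr fun x => ?_
    rw [← union_flipPairs_meeting, weight_union (disjoint_flipPairs_meeting hST hST),
      weight_eq_avoiding_mul_meeting T, dupMul_mul]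
    simp only [Pi.mul_apply, dupMul, weight_dup hmeet, Complex.conj_ofReal]
    push_cast
    ring

theorem IsQuasirandom.norm_sq_weightedExpect_doubledEdges_mul_le (h : IsQuasirandom ν D E δ)
    (hE : ∀ i, (i, i) ∉ E) {T : Finset I} {a : I} (ha : a ∉ T) {g G : (I × Fin 2 → X) → ℂ}
    (hg₁ : ∀ x, ‖g x‖ ≤ 1) (hg : DependsOn g {j | j.1 ≠ a}) (hG : DependsOn G {j | j ≠ (a, 1)}) :
    ‖weightedExpect ν D (doubledEdges E T) (g * G)‖ ^ 2 ≤
      (1 + δ) * ‖weightedExpect ν D (doubledEdges E (insert a T)) (dupMul {a} G)‖ := by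
  rw [doubledEdges_insert hE ha]
  exact h.norm_sq_weightedExpect_mul_le_union_flipPairs
    (fun z hz => (mem_doubledEdges.1 hz).1)
    (doubledEdges_subset_firstCopies E (disjoint_singleton_right.2 ha)) hg₁ (by simpa using hg)
    (firstCopies_singleton a ▸ hG)

theorem expect_weight_mul_sub_one_mul_sub_one (D : I → Finset X) {S₀ S₁ S₂ : Finset (DoubledPair I)}
    (h₀₁ : Disjoint S₀ S₁) (h₀₂ : Disjoint S₀ S₂) (h₁₂ : Disjoint S₁ S₂) :
    𝔼 x ∈ Fintype.piFinset fun j : I × Fin 2 => D j.1,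
        weight ν S₀ x * ((weight ν S₁ x - 1) * (weight ν S₂ x - 1))
      = (𝔼 x ∈ Fintype.piFinset fun j : I × Fin 2 => D j.1, weight ν (S₀ ∪ S₁ ∪ S₂) x)
        - (𝔼 x ∈ Fintype.piFinset fun j : I × Fin 2 => D j.1, weight ν (S₀ ∪ S₁) x)
        - (𝔼 x ∈ Fintype.piFinset fun j : I × Fin 2 => D j.1, weight ν (S₀ ∪ S₂) x)
        + 𝔼 x ∈ Fintype.piFinset fun j : I × Fin 2 => D j.1, weight ν S₀ x := by
  rw [← expect_sub_distrib, ← expect_sub_distrib, ← expect_add_distrib]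
  refine expect_congr rfl fun x _ => ?_
  rw [weight_union (disjoint_union_left.2 ⟨h₀₂, h₁₂⟩), weight_union h₀₁, weight_union h₀₂]
  ring

theorem IsQuasirandom.abs_expect_weight_mul_sub_one_mul_sub_one_le (h : IsQuasirandom ν D E δ)
    {S₀ S₁ S₂ : Finset (DoubledPair I)} (h₀ : ∀ z ∈ S₀, (z.1.1, z.2.1) ∈ E)
    (h₁ : ∀ z ∈ S₁, (z.1.1, z.2.1) ∈ E) (h₂ : ∀ z ∈ S₂, (z.1.1, z.2.1) ∈ E)
    (h₀₁ : Disjoint S₀ S₁) (h₀₂ : Disjoint S₀ S₂) (h₁₂ : Disjoint S₁ S₂) :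
    |𝔼 x ∈ Fintype.piFinset fun j : I × Fin 2 => D j.1,
        weight ν S₀ x * ((weight ν S₁ x - 1) * (weight ν S₂ x - 1))| ≤ 4 * δ := by
  have hunion {S S' : Finset (DoubledPair I)} (hS : ∀ z ∈ S, (z.1.1, z.2.1) ∈ E)
      (hS' : ∀ z ∈ S', (z.1.1, z.2.1) ∈ E) : ∀ z ∈ S ∪ S', (z.1.1, z.2.1) ∈ E := fun z hz =>
    (mem_union.1 hz).elim (hS z) (hS' z)
  have b₀ := abs_le.1 (h.abs_expect_weight_sub_one_le _ h₀)
  have b₁ := abs_le.1 (h.abs_expect_weight_sub_one_le _ (hunion h₀ h₁))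
  have b₂ := abs_le.1 (h.abs_expect_weight_sub_one_le _ (hunion h₀ h₂))
  have b₁₂ := abs_le.1 (h.abs_expect_weight_sub_one_le _ (hunion (hunion h₀ h₁) h₂))
  rw [expect_weight_mul_sub_one_mul_sub_one D h₀₁ h₀₂ h₁₂, abs_le]
  constructor <;> linarith

theorem IsQuasirandom.norm_sq_weightedExpect_sub_le (h : IsQuasirandom ν D E δ) {T : Finset I}
    {S : Finset (DoubledPair I)} (hSE : ∀ z ∈ S, (z.1.1, z.2.1) ∈ E)
    (hST : (S : Set (DoubledPair I)) ⊆ firstCopies T ×ˢ firstCopies T)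
    {g : (I × Fin 2 → X) → ℂ} (hg₁ : ∀ x, ‖g x‖ ≤ 1) (hg : DependsOn g {j | j.1 ∉ T}) :
    ‖weightedExpect ν D S g - weightedExpect ν D (avoiding T S) g‖ ^ 2 ≤ (1 + δ) * (4 * δ) := by
  have hE₀ : ∀ z ∈ avoiding T S, (z.1.1, z.2.1) ∈ E := fun z hz => hSE z (mem_filter.1 hz).1
  have hE₁ : ∀ z ∈ meeting T S, (z.1.1, z.2.1) ∈ E := fun z hz => hSE z (mem_filter.1 hz).1
  have hE₂ : ∀ z ∈ flipPairs T (meeting T S), (z.1.1, z.2.1) ∈ E := fun z hz => by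
    simpa using hE₁ _ (mem_flipPairs.1 hz)
  have hmeet : (meeting T S : Set (DoubledPair I)) ⊆ firstCopies T ×ˢ firstCopies T := fun z hz =>
    hST (mem_filter.1 hz).1
  have hdiff : weightedExpect ν D S g - weightedExpect ν D (avoiding T S) g
      = weightedExpect ν D (avoiding T S) (g * fun x => (weight ν (meeting T S) x : ℂ) - 1) := by
    rw [weightedExpect, weightedExpect, weightedExpect, ← expect_sub_distrib]
    refine expect_congr rfl fun x _ => ?_
    rw [weight_eq_avoiding_mul_meeting T, Pi.mul_apply]
    push_cast
    ring
  have hderiv : weightedExpect ν D (avoiding T S)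
        (dupMul T fun x => (weight ν (meeting T S) x : ℂ) - 1)
      = ((𝔼 x ∈ Fintype.piFinset fun j : I × Fin 2 => D j.1, weight ν (avoiding T S) x *
          ((weight ν (meeting T S) x - 1) * (weight ν (flipPairs T (meeting T S)) x - 1)) : ℝ) :
            ℂ) := by
    rw [Complex.ofReal_expect]
    refine expect_congr rfl fun x _ => ?_
    simp [dupMul, weight_dup hmeet]
  rw [hdiff]
  refine (h.norm_sq_weightedExpect_mul_le hE₀ (fun z hz => (mem_filter.1 hz).2) hg₁ hg
    fun x y hxy => by rw [dependsOn_weight hmeet hxy]).trans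
    (mul_le_mul_of_nonneg_left ?_ (by linarith [h.delta_nonneg]))
  rw [hderiv, Complex.norm_real]
  exact h.abs_expect_weight_mul_sub_one_mul_sub_one_le hE₀ hE₁ hE₂ (disjoint_avoiding_meeting T S)
    (disjoint_flipPairs_meeting (fun z hz => hST (mem_filter.1 hz).1) hST)
    (disjoint_flipPairs_meeting hmeet hST)

theorem pow_eight_le {a b c d r : ℝ} (hr : 0 ≤ r) (h₁ : a ^ 2 ≤ r * b) (h₂ : b ^ 2 ≤ r * c)
    (h₃ : c ^ 2 ≤ r * d) : a ^ 8 ≤ r ^ 7 * d := by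
  calc
    a ^ 8 = (a ^ 2) ^ 4 := by ring
    _ ≤ (r * b) ^ 4 := pow_le_pow_left₀ (sq_nonneg a) h₁ 4
    _ = r ^ 4 * (b ^ 2) ^ 2 := by ring
    _ ≤ r ^ 4 * (r * c) ^ 2 :=
      mul_le_mul_of_nonneg_left (pow_le_pow_left₀ (sq_nonneg b) h₂ 2) (pow_nonneg hr 4)
    _ = r ^ 6 * c ^ 2 := by ring
    _ ≤ r ^ 6 * (r * d) := mul_le_mul_of_nonneg_left h₃ (pow_nonneg hr 6)
    _ = r ^ 7 * d := by ring

theorem IsQuasirandom.norm_weightedExpect_doubledEdges_empty_pow_eight_le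
    (h : IsQuasirandom ν D E δ) (hE : ∀ i, (i, i) ∉ E) {i j k : I} (hij : i ≠ j) (hik : i ≠ k)
    (hjk : j ≠ k) {f g₁ g₂ g₃ : (I × Fin 2 → X) → ℂ} (hf : DependsOn f {(i, 0), (j, 0), (k, 0)})
    (hg₁ : DependsOn g₁ {z | z.2 = 0 ∧ z.1 ≠ k}) (hg₁' : ∀ x, ‖g₁ x‖ ≤ 1)
    (hg₂ : DependsOn g₂ {z | z.2 = 0 ∧ z.1 ≠ j}) (hg₂' : ∀ x, ‖g₂ x‖ ≤ 1)
    (hg₃ : DependsOn g₃ {z | z.2 = 0 ∧ z.1 ≠ i}) (hg₃' : ∀ x, ‖g₃ x‖ ≤ 1) :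
    ‖weightedExpect ν D (doubledEdges E ∅) (g₁ * (g₂ * (g₃ * f)))‖ ^ 8 ≤
      (1 + δ) ^ 7 * ‖weightedExpect ν D (doubledEdges E {i, j, k})
        (dupMul {i} (dupMul {j} (dupMul {k} f)))‖ := by
  have hfk : DependsOn (dupMul {k} f) {(i, 0), (j, 0), (k, 0), (k, 1)} :=
    dependsOn_dupMul hf (by simp [Set.insert_subset_iff]) (by simp)
  have hfj : DependsOn (dupMul {j} (dupMul {k} f)) {(i, 0), (j, 0), (j, 1), (k, 0), (k, 1)} :=
    dependsOn_dupMul hfk (by simp [Set.insert_subset_iff]) (by simp)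
  have hg₂k : DependsOn (dupMul {k} g₂) {z | z.1 ≠ j} :=
    dependsOn_dupMul hg₂ (fun z hz => hz.2) (by simp)
  have hg₃k : DependsOn (dupMul {k} g₃) {z | (z.2 = 0 ∨ z.1 = k) ∧ z.1 ≠ i} :=
    dependsOn_dupMul hg₃ (fun z hz => ⟨Or.inl hz.1, hz.2⟩) (by simp [hik.symm])
  have hg₃j : DependsOn (dupMul {j} (dupMul {k} g₃)) {z | z.1 ≠ i} :=
    dependsOn_dupMul hg₃k (fun z hz => hz.2) (by simp)
  have hfirst (z : I × Fin 2) (a : I) (hz : z.2 = 0) : z ≠ (a, 1) := by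
    rintro rfl
    simp at hz
  have hCSk := h.norm_sq_weightedExpect_doubledEdges_mul_le hE (notMem_empty k) hg₁'
    (hg₁.mono fun z hz => hz.2) (dependsOn_mul (hg₂.mono fun z hz => hfirst z k hz.1)
      (dependsOn_mul (hg₃.mono fun z hz => hfirst z k hz.1)
        (hf.mono (by simp [Set.insert_subset_iff]))))
  have hCSj := h.norm_sq_weightedExpect_doubledEdges_mul_le hE (T := insert k ∅) (a := j)
    (by simpa using hjk) (norm_dupMul_le hg₂' {k}) hg₂k
    (dependsOn_mul (G := dupMul {k} g₃) (H := dupMul {k} f)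
      (hg₃k.mono (by rintro z ⟨hz | hz, -⟩ rfl; exacts [by simp at hz, hjk hz]))
      (hfk.mono (by simp [Set.insert_subset_iff, hij, hjk.symm])))
  have hCSi := h.norm_sq_weightedExpect_doubledEdges_mul_le hE (T := insert j (insert k ∅))
    (a := i) (by simp [hij, hik]) (norm_dupMul_le (norm_dupMul_le hg₃' {k}) {j}) hg₃j
    (hfj.mono (by simp [Set.insert_subset_iff, hij.symm, hik.symm]))
  rw [dupMul_mul, dupMul_mul] at hCSk
  rw [dupMul_mul] at hCSj
  exact pow_eight_le (by linarith [h.delta_nonneg]) hCSk hCSj hCSi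

/-- The pairs of doubled vertices that lie over a pair in `E` contained in `T`: a complete blow-up
of the pairs of `E` inside `T`. -/
def blowUp (E : Finset (I × I)) (T : Finset I) : Finset (DoubledPair I) :=
  avoiding Tᶜ (doubledEdges E T)

/-- The generalised von Neumann inequality. Doubling `k`, `j` and `i` in turn by Cauchy–Schwarz
eliminates `g₁`, `g₂` and `g₃`; quasirandomness then allows the weights at all other vertices to be
discarded. -/
theorem IsQuasirandom.norm_weightedExpect_pow_eight_le (h : IsQuasirandom ν D E δ)
    (hE : ∀ i, (i, i) ∉ E) {i j k : I} (hij : i ≠ j) (hik : i ≠ k)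
    (hjk : j ≠ k) {f g₁ g₂ g₃ : (I × Fin 2 → X) → ℂ} (hf : DependsOn f {(i, 0), (j, 0), (k, 0)})
    (hf' : ∀ x, ‖f x‖ ≤ 1)
    (hg₁ : DependsOn g₁ {z | z.2 = 0 ∧ z.1 ≠ k}) (hg₁' : ∀ x, ‖g₁ x‖ ≤ 1)
    (hg₂ : DependsOn g₂ {z | z.2 = 0 ∧ z.1 ≠ j}) (hg₂' : ∀ x, ‖g₂ x‖ ≤ 1)
    (hg₃ : DependsOn g₃ {z | z.2 = 0 ∧ z.1 ≠ i}) (hg₃' : ∀ x, ‖g₃ x‖ ≤ 1) :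
    ‖weightedExpect ν D (doubledEdges E ∅) (g₁ * (g₂ * (g₃ * f)))‖ ^ 8 ≤
      (1 + δ) ^ 7 * (‖weightedExpect ν D (blowUp E {i, j, k})
        (dupMul {i} (dupMul {j} (dupMul {k} f)))‖ + √((1 + δ) * (4 * δ))) := by
  have hδ := h.delta_nonneg
  have hdep : DependsOn (dupMul {i} (dupMul {j} (dupMul {k} f)))
      {z | z.1 ∉ ({i, j, k} : Finset I)ᶜ} := by
    refine dependsOn_dupMul (s := {z | z.1 = i ∨ z.1 = j ∨ z.1 = k}) (dependsOn_dupMul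
      (s := {z | z.1 = i ∨ z.1 = j ∨ z.1 = k}) (dependsOn_dupMul hf ?_ ?_) ?_ ?_) ?_ ?_ <;>
    simp [Set.insert_subset_iff]
  have hdiscard := Real.le_sqrt_of_sq_le (h.norm_sq_weightedExpect_sub_le
    (fun z hz => (mem_doubledEdges.1 hz).1)
    (doubledEdges_subset_firstCopies E (disjoint_compl_right : Disjoint {i, j, k} _))
    (norm_dupMul_le (norm_dupMul_le (norm_dupMul_le hf' {k}) {j}) {i}) hdep)
  refine (h.norm_weightedExpect_doubledEdges_empty_pow_eight_le hE hij hik hjk hf hg₁ hg₁' hg₂ hg₂'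
    hg₃ hg₃').trans (mul_le_mul_of_nonneg_left ?_ (by positivity))
  exact (norm_le_norm_add_norm_sub' _ _).trans (add_le_add_right hdiscard _)

end GeneralizedVonNeumann

section DoubledAverages

variable {X : Type*}

theorem expect_piFinset_sum {α β : Type*} [Fintype α] [Fintype β] [DecidableEq α] [DecidableEq β]
    (D : α ⊕ β → Finset X) (f : (α ⊕ β → X) → ℂ) :
    𝔼 x ∈ Fintype.piFinset D, f x = 𝔼 y ∈ Fintype.piFinset fun a => D (Sum.inl a),
      𝔼 z ∈ Fintype.piFinset fun b => D (Sum.inr b), f (Sum.elim y z) := by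
  rw [← expect_product']
  refine expect_nbij' (fun x => (x ∘ Sum.inl, x ∘ Sum.inr)) (fun z => Sum.elim z.1 z.2)
    (fun x hx => ?_) (fun z hz => ?_) (fun x _ => Sum.elim_comp_inl_inr x) (fun _ _ => rfl)
    (fun x _ => congrArg f (Sum.elim_comp_inl_inr x).symm)
  · rw [Fintype.mem_piFinset] at hx
    exact mem_product.2 ⟨Fintype.mem_piFinset.2 fun a => hx _, Fintype.mem_piFinset.2 fun b => hx _⟩
  · rw [mem_product, Fintype.mem_piFinset, Fintype.mem_piFinset] at hz
    exact Fintype.mem_piFinset.2 (Sum.rec hz.1 hz.2)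

theorem injective_copies {I : Type*} {i j k : I} (hij : i ≠ j) (hik : i ≠ k) (hjk : j ≠ k) :
    Function.Injective (Sum.elim (fun b => (i, b)) (Sum.elim (fun b => (j, b)) fun b => (k, b)) :
      Fin 2 ⊕ Fin 2 ⊕ Fin 2 → I × Fin 2) := by
  rintro (a | a | a) (b | b | b) h <;> simp_all [eq_comm]

variable {I : Type*} [Fintype I] [DecidableEq I] {ν : I × I → X → X → ℝ} {D : I → Finset X}
  {E : Finset (I × I)} {δ : ℝ}

theorem mem_blowUp {T : Finset I} {z : DoubledPair I} :
    z ∈ blowUp E T ↔ (z.1.1, z.2.1) ∈ E ∧ z.1.1 ∈ T ∧ z.2.1 ∈ T := by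
  simp only [blowUp, avoiding, mem_filter, mem_doubledEdges, mem_compl, not_not]
  tauto

theorem weight_doubledEdges_empty (E : Finset (I × I)) (x : I × Fin 2 → X) :
    weight ν (doubledEdges E ∅) x = ∏ z ∈ E, ν z (x (z.1, 0)) (x (z.2, 0)) := by
  have hfst : ∀ z ∈ doubledEdges E ∅, ((z.1.1, 0), (z.2.1, 0)) = z := fun z hz => by
    have hz := (mem_doubledEdges.1 hz).2
    exact Prod.ext (Prod.ext rfl (hz.1 (notMem_empty _)).symm)
      (Prod.ext rfl (hz.2 (notMem_empty _)).symm)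
  refine prod_nbij' (fun z => (z.1.1, z.2.1)) (fun z => ((z.1, 0), (z.2, 0)))
    (fun z hz => (mem_doubledEdges.1 hz).1) (fun z hz => by simpa [mem_doubledEdges] using hz)
    hfst (fun _ _ => rfl) fun z hz => ?_
  conv_lhs => rw [← hfst z hz]

theorem weight_blowUp_triple {i j k : I} (hij : i ≠ j) (hjk : j ≠ k)
    (hE : E ∩ ({i, j, k} ×ˢ {i, j, k}) = {(i, j), (i, k), (j, k)}) (x : I × Fin 2 → X) :
    weight ν (blowUp E {i, j, k}) x =
      (∏ a, ∏ b, ν (i, j) (x (i, a)) (x (j, b))) * (∏ a, ∏ b, ν (i, k) (x (i, a)) (x (k, b))) *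
        ∏ a, ∏ b, ν (j, k) (x (j, a)) (x (k, b)) := by
  have hprod : weight ν (blowUp E {i, j, k}) x =
      ∏ z ∈ ({(i, j), (i, k), (j, k)} : Finset (I × I)) ×ˢ (univ : Finset (Fin 2 × Fin 2)),
        ν z.1 (x (z.1.1, z.2.1)) (x (z.1.2, z.2.2)) := by
    rw [← hE]
    refine prod_nbij' (fun z => ((z.1.1, z.2.1), (z.1.2, z.2.2)))
      (fun z => ((z.1.1, z.2.1), (z.1.2, z.2.2))) ?_ ?_ (fun _ _ => rfl) (fun _ _ => rfl)
      (fun _ _ => rfl) <;>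
    · intro z hz
      simpa [mem_blowUp] using hz
  rw [hprod, prod_product, prod_insert (by simp [hij, hjk]), prod_insert (by simp [hij]),
    prod_singleton, ← mul_assoc]
  simp only [Fintype.prod_prod_type]

theorem dupMul_triple [Add X] {i j k : I} (hij : i ≠ j) (hik : i ≠ k) (hjk : j ≠ k) (f : X → ℂ)
    (x : I × Fin 2 → X) :
    dupMul {i} (dupMul {j} (dupMul {k} fun x => f (x (i, 0) + x (j, 0) + x (k, 0)))) x =
      ∏ ω : Fin 2 × Fin 2 × Fin 2, (starRingEnd ℂ)^[(ω.1 : ℕ) + (ω.2.1 : ℕ) + (ω.2.2 : ℕ)]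
        (f (x (i, ω.1) + x (j, ω.2.1) + x (k, ω.2.2))) := by
  simp only [dupMul, dup, flipCopy, Fintype.prod_prod_type, Fin.prod_univ_two, Fin.val_zero,
    Fin.val_one, Function.iterate_succ, Function.iterate_zero, Function.comp, id, map_mul,
    Complex.conj_conj, add_zero, mem_filter, mem_univ, true_and, mem_singleton, piecewise,
    hij, hik, hjk, hij.symm, hik.symm, hjk.symm, and_true, if_true, if_false, zero_add,
    false_and, one_ne_zero]

theorem IsQuasirandom.nonempty (h : IsQuasirandom ν D E δ) (hδ : δ < 1) (i : I) :
    (D i).Nonempty := by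
  suffices (Fintype.piFinset fun j : I × Fin 2 => D j.1).Nonempty from
    Fintype.piFinset_nonempty.1 this (i, 0)
  by_contra hempty
  have hone := h.abs_expect_weight_sub_one_le ∅ (by simp)
  rw [not_nonempty_iff_eq_empty.1 hempty, expect_empty, zero_sub, abs_neg, abs_one] at hone
  linarith

theorem IsQuasirandom.expect_comp_injective (h : IsQuasirandom ν D E δ) (hδ : δ < 1) {K : Type*}
    [Fintype K] [DecidableEq K] {φ : K → I × Fin 2} (hφ : Function.Injective φ)
    (G : (K → X) → ℂ) :
    𝔼 x ∈ Fintype.piFinset fun j : I × Fin 2 => D j.1, G (x ∘ φ) =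
      𝔼 y ∈ Fintype.piFinset fun a => D (φ a).1, G y := by
  exact TernaryCount.expect_comp_injective (D := fun j : I × Fin 2 => D j.1)
    (fun j => h.nonempty hδ j.1) hφ G

theorem IsQuasirandom.norm_weightedExpect_one_sub_one_le (h : IsQuasirandom ν D E δ) :
    ‖weightedExpect ν D (doubledEdges E ∅) 1 - 1‖ ≤ δ := by
  have hone : weightedExpect ν D (doubledEdges E ∅) 1 - 1 = ((
      (𝔼 x ∈ Fintype.piFinset fun j : I × Fin 2 => D j.1, weight ν (doubledEdges E ∅) x) - 1 :
        ℝ) : ℂ) := by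
    simp [weightedExpect, Complex.ofReal_expect]
  rw [hone, Complex.norm_real, Real.norm_eq_abs]
  exact h.abs_expect_weight_sub_one_le _ fun z hz => (mem_doubledEdges.1 hz).1

end DoubledAverages

section TripartiteSystem

open Sum

variable {p n l q : ℕ} {U V W : Type*}

/-- The label of the atom of a vertex. -/
def LabelFamily.vertex (e : LabelFamily p l q U V W) : U ⊕ V ⊕ W → AtomLabel p l q :=
  Sum.elim e.a (Sum.elim e.b e.c)

/-- The label of the bilinear level set of a pair of vertices from different classes, in the order
of the classes. The value at all other pairs is irrelevant. -/
def LabelFamily.pair (e : LabelFamily p l q U V W) : (U ⊕ V ⊕ W) × (U ⊕ V ⊕ W) → Fin q → ZMod p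
  | (inl u, inr (inl v)) => e.dUV u v
  | (inl u, inr (inr w)) => e.dUW u w
  | (inr (inl v), inr (inr w)) => e.dVW v w
  | _ => 0

/-- A pair of vertices from different classes, in the order of the classes. -/
def crossing : (U ⊕ V ⊕ W) × (U ⊕ V ⊕ W) → Bool
  | (inl _, inr _) => true
  | (inr (inl _), inr (inr _)) => true
  | _ => false

/-- The value of `f u v w` at the sum of the first copies of `u`, `v` and `w`. -/
def entry {X : Type*} [Add X] (f : U → V → W → X → ℂ) (t : U × V × W)
    (x : (U ⊕ V ⊕ W) × Fin 2 → X) : ℂ :=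
  f t.1 t.2.1 t.2.2 (x (inl t.1, 0) + x (inr (inl t.2.1), 0) + x (inr (inr t.2.2), 0))

theorem dependsOn_prod_entry {X : Type*} [Add X] (f : U → V → W → X → ℂ) {s : Finset (U × V × W)}
    {r : Set ((U ⊕ V ⊕ W) × Fin 2)}
    (h : ∀ t ∈ s, {(inl t.1, 0), (inr (inl t.2.1), 0), (inr (inr t.2.2), 0)} ⊆ r) :
    DependsOn (∏ t ∈ s, entry f t ·) r := fun x y hxy => by
  refine prod_congr rfl fun t ht => ?_
  have ht := h t ht
  simp only [Set.insert_subset_iff, Set.singleton_subset_iff] at ht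
  rw [entry, entry, hxy _ ht.1, hxy _ ht.2.1, hxy _ ht.2.2]

theorem norm_prod_entry_le {X : Type*} [Add X] {f : U → V → W → X → ℂ}
    (hf : ∀ u v w y, ‖f u v w y‖ ≤ 1) (s : Finset (U × V × W)) (x : (U ⊕ V ⊕ W) × Fin 2 → X) :
    ‖∏ t ∈ s, entry f t x‖ ≤ 1 := by
  rw [norm_prod]
  exact prod_le_one (fun _ _ => norm_nonneg _) fun _ _ => hf _ _ _ _

variable [Fintype U] [Fintype V] [Fintype W]

/-- The pairs of vertices from different classes, in the order of the classes. -/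
def crossingPairs (U V W : Type*) [Fintype U] [Fintype V] [Fintype W] :
    Finset ((U ⊕ V ⊕ W) × (U ⊕ V ⊕ W)) :=
  univ.filter fun z => crossing z = true

theorem mem_crossingPairs {z : (U ⊕ V ⊕ W) × (U ⊕ V ⊕ W)} :
    z ∈ crossingPairs U V W ↔ crossing z = true := by
  simp [crossingPairs]

theorem prod_crossingPairs {M : Type*} [CommMonoid M] (g : (U ⊕ V ⊕ W) × (U ⊕ V ⊕ W) → M) :
    ∏ z ∈ crossingPairs U V W, g z =
      (∏ u, ∏ v, g (inl u, inr (inl v))) * (∏ u, ∏ w, g (inl u, inr (inr w))) *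
        ∏ v, ∏ w, g (inr (inl v), inr (inr w)) := by
  rw [crossingPairs, prod_filter, Fintype.prod_prod_type]
  simp [Fintype.prod_sum_type, crossing, prod_mul_distrib, mul_assoc]

theorem swap_notMem_crossingPairs {z : (U ⊕ V ⊕ W) × (U ⊕ V ⊕ W)} (hz : z ∈ crossingPairs U V W) :
    z.swap ∉ crossingPairs U V W := by
  rw [mem_crossingPairs] at hz ⊢
  obtain ⟨u | v | w, u' | v' | w'⟩ := z <;> simp_all [crossing]

variable [DecidableEq U] [DecidableEq V] [DecidableEq W]

theorem crossingPairs_inter_triple (u : U) (v : V) (w : W) :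
    crossingPairs U V W ∩
        ({inl u, inr (inl v), inr (inr w)} ×ˢ {inl u, inr (inl v), inr (inr w)}) =
      {(inl u, inr (inl v)), (inl u, inr (inr w)), (inr (inl v), inr (inr w))} := by
  ext ⟨a | a | a, b | b | b⟩ <;> simp [mem_crossingPairs, crossing]

theorem prod_univ_eq_mul_apply {M : Type*} [CommMonoid M] (h : U × V × W → M) (u : U) (v : V)
    (w : W) :
    ∏ t, h t = (∏ t with t.1 = u ∧ t.2.1 = v ∧ t.2.2 ≠ w, h t) *
      ((∏ t with t.1 = u ∧ t.2.1 ≠ v, h t) * ((∏ t with t.1 ≠ u, h t) * h (u, v, w))) := by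
  have hsingle : ({t | t.1 = u ∧ t.2.1 = v ∧ t.2.2 = w} : Finset (U × V × W)) = {(u, v, w)} := by
    ext ⟨u', v', w'⟩
    simp
  rw [← prod_filter_mul_prod_filter_not univ (fun t : U × V × W => t.1 = u),
    ← prod_filter_mul_prod_filter_not (univ.filter fun t : U × V × W => t.1 = u)
      (fun t => t.2.1 = v),
    ← prod_filter_mul_prod_filter_not ((univ.filter fun t : U × V × W => t.1 = u).filter
      fun t => t.2.1 = v) (fun t => t.2.2 = w)]
  simp only [filter_filter, and_assoc, hsingle, prod_singleton]
  rw [mul_comm (h _), mul_assoc, mul_assoc, mul_comm (h _), mul_assoc]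

variable [Fact p.Prime]

/-- The characteristic measures of the bilinear level sets prescribed by `e` are jointly
quasirandom over the atoms prescribed by `e`, up to `δ`. -/
abbrev LabelFamily.IsQuasirandom (e : LabelFamily p l q U V W) (B : QuadraticFactor p n l q)
    (δ : ℝ) : Prop :=
  TernaryCount.IsQuasirandom (fun z => B.mu (e.pair z)) (fun i => B.atom (e.vertex i))
    (crossingPairs U V W) δ

theorem LabelFamily.isQuasirandom (e : LabelFamily p l q U V W) {B : QuadraticFactor p n l q}
    (hp : 2 < p) {K s : ℕ} (hB : ∀ c : Fin q → ZMod p, c ≠ 0 →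
      2 * (K * (l + q) + s) ≤ (∑ j, c j • B.M j).rank) (hK₀ : 0 < K)
    (hK : 2 * Fintype.card (U ⊕ V ⊕ W) + (2 * Fintype.card (U ⊕ V ⊕ W)) ^ 2 ≤ K) {δ : ℝ}
    (hδ : δ ≤ 1) (hs : 2 * ((K : ℝ) + 2) / 3 ^ s ≤ δ) : e.IsQuasirandom B δ := by
  refine ⟨fun _ _ _ => B.mu_nonneg _ _ _, fun S hS => ?_⟩
  have hcard : Fintype.card ((U ⊕ V ⊕ W) × Fin 2) = 2 * Fintype.card (U ⊕ V ⊕ W) := by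
    rw [Fintype.card_prod, Fintype.card_fin, mul_comm]
  have hle : #S ≤ (2 * Fintype.card (U ⊕ V ⊕ W)) ^ 2 := by
    rw [← hcard, sq, ← Fintype.card_prod]
    exact card_le_univ S
  have hexpect := B.abs_expect_prod_mu_sub_one_le hp hB (fun j => e.vertex j.1)
    (fun z hz hz' => swap_notMem_crossingPairs (hS z hz) (hS _ hz')) hK₀
    ((add_le_add hcard.le hle).trans hK) (fun z => e.pair (z.1.1, z.2.1)) hδ hs
  exact hexpect

variable {B : QuadraticFactor p n l q} {e : LabelFamily p l q U V W} {δ : ℝ}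

theorem ternaryOp_eq_expect (B : QuadraticFactor p n l q) (e : LabelFamily p l q U V W)
    (f : U → V → W → Vec p n → ℂ) :
    ternaryOp B e f = 𝔼 x ∈ Fintype.piFinset fun i => B.atom (e.vertex i),
      ((∏ z ∈ crossingPairs U V W, B.mu (e.pair z) (x z.1) (x z.2) : ℝ) : ℂ) *
        ∏ t : U × V × W,
          f t.1 t.2.1 t.2.2 (x (inl t.1) + x (inr (inl t.2.1)) + x (inr (inr t.2.2))) := by
  rw [expect_piFinset_sum, ternaryOp]
  refine expect_congr rfl fun x _ => ?_
  rw [expect_piFinset_sum]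
  refine expect_congr rfl fun y _ => expect_congr rfl fun z _ => ?_
  simp only [prod_crossingPairs, Fintype.prod_prod_type]
  push_cast
  rfl

theorem LabelFamily.IsQuasirandom.ternaryOp_eq_weightedExpect (h : e.IsQuasirandom B δ)
    (hδ : δ < 1) (f : U → V → W → Vec p n → ℂ) :
    ternaryOp B e f = weightedExpect (fun z => B.mu (e.pair z)) (fun i => B.atom (e.vertex i))
      (doubledEdges (crossingPairs U V W) ∅) (∏ t, entry f t ·) := by
  rw [ternaryOp_eq_expect]
  refine (h.expect_comp_injective hδ (φ := fun i => (i, 0)) (Prod.mk_left_injective 0) _).symm.trans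
    (expect_congr rfl fun x _ => ?_)
  rw [weight_doubledEdges_empty]
  rfl

theorem localU3Inner_eq_expect (B : QuadraticFactor p n l q) (d : SixLabel p l q)
    (f : Vec p n → ℂ) :
    B.localU3Inner d (fun _ => f) =
      𝔼 x ∈ Fintype.piFinset (Sum.elim (fun _ : Fin 2 => B.atom d.a₁)
          (Sum.elim (fun _ : Fin 2 => B.atom d.a₂) fun _ : Fin 2 => B.atom d.a₃)),
        (((∏ i, ∏ j, B.mu d.b₁₂ (x (inl i)) (x (inr (inl j)))) *
          (∏ i, ∏ k, B.mu d.b₁₃ (x (inl i)) (x (inr (inr k)))) *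
          ∏ j, ∏ k, B.mu d.b₂₃ (x (inr (inl j))) (x (inr (inr k))) : ℝ) : ℂ) *
        ∏ ω : Fin 2 × Fin 2 × Fin 2, (starRingEnd ℂ)^[(ω.1 : ℕ) + (ω.2.1 : ℕ) + (ω.2.2 : ℕ)]
          (f (x (inl ω.1) + x (inr (inl ω.2.1)) + x (inr (inr ω.2.2)))) := by
  rw [expect_piFinset_sum, QuadraticFactor.localU3Inner]
  refine expect_congr rfl fun x _ => ?_
  rw [expect_piFinset_sum]
  refine expect_congr rfl fun y _ => expect_congr rfl fun z _ => ?_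
  push_cast
  rfl

theorem LabelFamily.IsQuasirandom.weightedExpect_blowUp_eq_localU3Inner (h : e.IsQuasirandom B δ)
    (hδ : δ < 1) (f : U → V → W → Vec p n → ℂ) (u : U) (v : V) (w : W) :
    weightedExpect (fun z => B.mu (e.pair z)) (fun i => B.atom (e.vertex i))
        (blowUp (crossingPairs U V W) {inl u, inr (inl v), inr (inr w)})
        (dupMul {inl u} (dupMul {inr (inl v)} (dupMul {inr (inr w)} (entry f (u, v, w))))) =
      B.localU3Inner (e.tuple u v w) fun _ => f u v w := by
  rw [localU3Inner_eq_expect]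
  have hφ := injective_copies (i := (inl u : U ⊕ V ⊕ W)) (j := inr (inl v)) (k := inr (inr w))
    (by simp) (by simp) (by simp)
  have hdomain : (Sum.elim (fun _ : Fin 2 => B.atom (e.tuple u v w).a₁)
      (Sum.elim (fun _ : Fin 2 => B.atom (e.tuple u v w).a₂)
        fun _ : Fin 2 => B.atom (e.tuple u v w).a₃)) = fun a => B.atom (e.vertex (Sum.elim
          (fun b => ((inl u : U ⊕ V ⊕ W), b)) (Sum.elim (fun b => (inr (inl v), b))
            fun b => (inr (inr w), b)) a).1) := by
    funext a
    rcases a with a | a | a <;> rfl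
  rw [hdomain, ← h.expect_comp_injective hδ hφ]
  refine expect_congr rfl fun x _ => ?_
  rw [weight_blowUp_triple (by simp) (by simp) (crossingPairs_inter_triple u v w)]
  congr 1
  exact dupMul_triple (by simp) (by simp) (by simp) (f u v w) x

theorem localU3Norm_nonneg (B : QuadraticFactor p n l q) (d : SixLabel p l q) (f : Vec p n → ℂ) :
    0 ≤ B.localU3Norm d f :=
  Real.rpow_nonneg (Complex.nonneg_iff.1 (B.localU3Inner_self_nonneg d f)).1 _

theorem norm_localU3Inner (B : QuadraticFactor p n l q) (d : SixLabel p l q) (f : Vec p n → ℂ) :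
    ‖B.localU3Inner d fun _ => f‖ = B.localU3Norm d f ^ 8 := by
  have hnonneg := B.localU3Inner_self_nonneg d f
  have hre := (Complex.nonneg_iff.1 hnonneg).1
  rw [QuadraticFactor.localU3Norm, ← Real.rpow_natCast, ← Real.rpow_mul hre, Nat.cast_ofNat,
    one_div_mul_cancel (by norm_num), Real.rpow_one, Complex.re_eq_norm.2 hnonneg]

theorem LabelFamily.IsQuasirandom.norm_ternaryOp_pow_eight_le (h : e.IsQuasirandom B δ)
    (hδ : δ < 1) {f : U → V → W → Vec p n → ℂ} (hf : ∀ u v w y, ‖f u v w y‖ ≤ 1)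
    (u : U) (v : V) (w : W) :
    ‖ternaryOp B e f‖ ^ 8 ≤ (1 + δ) ^ 7 *
      (B.localU3Norm (e.tuple u v w) (f u v w) ^ 8 + √((1 + δ) * (4 * δ))) := by
  rw [h.ternaryOp_eq_weightedExpect hδ, ← norm_localU3Inner,
    ← h.weightedExpect_blowUp_eq_localU3Inner hδ]
  simp only [prod_univ_eq_mul_apply _ u v w]
  have hentry := dependsOn_prod_entry f (s := {(u, v, w)})
    (r := {(inl u, 0), (inr (inl v), 0), (inr (inr w), 0)}) (by simp)
  simp only [prod_singleton] at hentry
  refine h.norm_weightedExpect_pow_eight_le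
    (fun i hi => swap_notMem_crossingPairs hi hi) (by simp) (by simp) (by simp) hentry
    (fun x => hf _ _ _ _) (dependsOn_prod_entry f fun t ht => ?_) (norm_prod_entry_le hf _)
    (dependsOn_prod_entry f fun t ht => ?_) (norm_prod_entry_le hf _)
    (dependsOn_prod_entry f fun t ht => ?_) (norm_prod_entry_le hf _) <;>
  · rw [mem_filter] at ht
    simp [Set.insert_subset_iff, ht]

end TripartiteSystem

section Counting

open Sum

variable {p n l q : ℕ} [Fact p.Prime] {U V W : Type*} [Fintype U] [Fintype V] [Fintype W]

theorem mem_tupleSet_iff [Nonempty U] [Nonempty V] [Nonempty W] {B : QuadraticFactor p n l q}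
    {e : LabelFamily p l q U V W} {x : U ⊕ V ⊕ W → Vec p n} :
    (x ∘ inl, x ∘ inr ∘ inl, x ∘ inr ∘ inr) ∈ tupleSet B e ↔
      (∀ i, x i ∈ B.atom (e.vertex i)) ∧
        ∀ z ∈ crossingPairs U V W, (x z.1, x z.2) ∈ B.beta (e.pair z) := by
  simp only [tupleSet, Set.mem_ofPred_eq, mem_crossingPairs, Sum.forall, Prod.forall, crossing,
    LabelFamily.vertex, LabelFamily.pair, Function.comp, forall_and, forall_const, Sum.elim_inl,
    Sum.elim_inr, and_assoc, Bool.false_eq_true, IsEmpty.forall_iff, and_true, true_and]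

variable [DecidableEq U] [DecidableEq V] [DecidableEq W]

theorem localU3Norm_neg (B : QuadraticFactor p n l q) (d : SixLabel p l q) (f : Vec p n → ℂ) :
    B.localU3Norm d (-f) = B.localU3Norm d f := by
  simp only [QuadraticFactor.localU3Norm, QuadraticFactor.localU3Inner, Fintype.prod_prod_type,
    Fin.prod_univ_two, Fin.val_zero, Fin.val_one, Function.iterate_succ, Function.iterate_zero,
    Function.comp, id, add_zero, Pi.neg_apply, map_neg, mul_neg, neg_mul, neg_neg]

theorem ternaryOp_add_of_eq_off {B : QuadraticFactor p n l q} {e : LabelFamily p l q U V W}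
    {f g h : U × V × W → Vec p n → ℂ} {t₀ : U × V × W} (h₀ : g t₀ + h t₀ = f t₀)
    (hg : ∀ t ≠ t₀, g t = f t) (hh : ∀ t ≠ t₀, h t = f t) :
    ternaryOp B e (fun u v w => g (u, v, w)) + ternaryOp B e (fun u v w => h (u, v, w))
      = ternaryOp B e fun u v w => f (u, v, w) := by
  simp only [ternaryOp_eq_expect, ← expect_add_distrib, ← mul_add]
  refine expect_congr rfl fun x _ => congrArg _ ?_
  exact prod_add_prod_eq (mem_univ t₀) (congrFun h₀ _) (fun t _ ht => congrFun (hg t ht) _)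
    fun t _ ht => congrFun (hh t ht) _

theorem norm_ternaryOp_sub_le_of_eq_off {B : QuadraticFactor p n l q}
    {e : LabelFamily p l q U V W} {f g : U × V × W → Vec p n → ℂ} {t₀ : U × V × W} {M : ℝ}
    (hfg : ∀ t ≠ t₀, g t = f t) (hM : ‖ternaryOp B e fun u v w =>
      Function.update f t₀ (f t₀ - g t₀) (u, v, w)‖ ≤ M) :
    ‖ternaryOp B e (fun u v w => f (u, v, w)) - ternaryOp B e (fun u v w => g (u, v, w))‖ ≤ M := by
  rwa [← ternaryOp_add_of_eq_off (f := f) (g := g) (h := Function.update f t₀ (f t₀ - g t₀))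
    (t₀ := t₀) (by simp) hfg (fun t ht => Function.update_of_ne ht _ _), add_sub_cancel_left]

theorem norm_ternaryOp_sub_le {B : QuadraticFactor p n l q} {e : LabelFamily p l q U V W}
    {f g : U × V × W → Vec p n → ℂ} {M : ℝ} (hf : ∀ t y, ‖f t y‖ ≤ 1) (hg : ∀ t y, ‖g t y‖ ≤ 1)
    (hfg : ∀ t y, ‖f t y - g t y‖ ≤ 1)
    (hM : ∀ (h : U × V × W → Vec p n → ℂ) t₀, (∀ t y, ‖h t y‖ ≤ 1) → h t₀ = f t₀ - g t₀ →
      ‖ternaryOp B e fun u v w => h (u, v, w)‖ ≤ M) :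
    ‖ternaryOp B e (fun u v w => f (u, v, w)) - ternaryOp B e (fun u v w => g (u, v, w))‖
      ≤ Fintype.card (U × V × W) * M := by
  suffices ∀ s : Finset (U × V × W),
      ‖ternaryOp B e (fun u v w => s.piecewise f g (u, v, w)) -
        ternaryOp B e (fun u v w => g (u, v, w))‖ ≤ #s * M by simpa using this univ
  intro s
  induction s using Finset.induction_on with
  | empty => simp
  | insert t₀ s hs ih =>
    have hstep : ‖ternaryOp B e (fun u v w => (insert t₀ s).piecewise f g (u, v, w)) -
        ternaryOp B e (fun u v w => s.piecewise f g (u, v, w))‖ ≤ M := by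
      refine norm_ternaryOp_sub_le_of_eq_off (t₀ := t₀) (fun t ht => ?_)
        (hM _ t₀ (fun t y => ?_) ?_)
      · rw [piecewise_insert, Function.update_of_ne ht]
      · rcases eq_or_ne t t₀ with rfl | ht
        · simpa [hs] using hfg t y
        · by_cases hts : t ∈ s <;> simp [ht, hts, hf, hg]
      · simp [hs]
    calc _ ≤ _ := norm_sub_le_norm_sub_add_norm_sub _
          (ternaryOp B e fun u v w => s.piecewise f g (u, v, w)) _
      _ ≤ M + #s * M := add_le_add hstep ih
      _ = #(insert t₀ s) * M := by
        rw [card_insert_of_notMem hs]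
        push_cast
        ring

theorem ternaryOp_const (B : QuadraticFactor p n l q) (e : LabelFamily p l q U V W)
    (c : U → V → W → ℂ) :
    ternaryOp B e (fun u v w _ => c u v w) =
      (∏ t : U × V × W, c t.1 t.2.1 t.2.2) * ternaryOp B e fun _ _ _ _ => 1 := by
  simp only [ternaryOp_eq_expect, prod_const_one, mul_one]
  rw [← expect_mul, mul_comm]

theorem LabelFamily.IsQuasirandom.norm_ternaryOp_one_sub_one_le {B : QuadraticFactor p n l q}
    {e : LabelFamily p l q U V W} {δ : ℝ} (h : e.IsQuasirandom B δ) (hδ : δ < 1) :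
    ‖ternaryOp B e (fun _ _ _ _ => 1) - 1‖ ≤ δ := by
  rw [h.ternaryOp_eq_weightedExpect hδ]
  simp only [entry, prod_const_one]
  exact h.norm_weightedExpect_one_sub_one_le

open Classical in
theorem ncard_tupleSet_sep [Nonempty U] [Nonempty V] [Nonempty W] (B : QuadraticFactor p n l q)
    (e : LabelFamily p l q U V W) (R : (U → Vec p n) × (V → Vec p n) × (W → Vec p n) → Prop) :
    {t ∈ tupleSet B e | R t}.ncard = #{x ∈ Fintype.piFinset fun i => B.atom (e.vertex i) |
      (∀ z ∈ crossingPairs U V W, (x z.1, x z.2) ∈ B.beta (e.pair z)) ∧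
        R (x ∘ inl, x ∘ inr ∘ inl, x ∘ inr ∘ inr)} := by
  let φ : (U ⊕ V ⊕ W → Vec p n) ≃ (U → Vec p n) × (V → Vec p n) × (W → Vec p n) :=
    (Equiv.sumArrowEquivProdArrow U (V ⊕ W) _).trans
      ((Equiv.refl _).prodCongr (Equiv.sumArrowEquivProdArrow V W _))
  rw [← Set.ncard_coe_finset, ← Set.ncard_preimage_of_injective_subset_range φ.injective
    (φ.surjective.range_eq ▸ Set.subset_univ _)]
  congr 1
  ext x
  have hφ : φ x = (x ∘ inl, x ∘ inr ∘ inl, x ∘ inr ∘ inr) := rfl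
  rw [Set.mem_preimage, Set.mem_ofPred_eq, hφ, mem_tupleSet_iff, coe_filter, Set.mem_ofPred_eq,
    Fintype.mem_piFinset, and_assoc]

/-- The common value of the product of the characteristic measures on the tuples of `tupleSet B e`,
divided by the number of all tuples in the atoms: the proportionality constant between values of
`ternaryOp` and numbers of tuples. -/
noncomputable def weightScale (B : QuadraticFactor p n l q) (e : LabelFamily p l q U V W) : ℝ :=
  (∏ z ∈ crossingPairs U V W, (p : ℝ) ^ (2 * n) / #(B.beta (e.pair z))) /
    #(Fintype.piFinset fun i => B.atom (e.vertex i))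

theorem weightScale_nonneg (B : QuadraticFactor p n l q) (e : LabelFamily p l q U V W) :
    0 ≤ weightScale B e :=
  div_nonneg (prod_nonneg fun _ _ => by positivity) (by positivity)

open Classical in
theorem ternaryOp_indicator [Nonempty U] [Nonempty V] [Nonempty W] (B : QuadraticFactor p n l q)
    (e : LabelFamily p l q U V W) (Q : U → V → W → Vec p n → Prop) :
    ternaryOp B e (fun u v w y => if Q u v w y then 1 else 0) =
      ((weightScale B e *
        {t ∈ tupleSet B e | ∀ u v w, Q u v w (t.1 u + t.2.1 v + t.2.2 w)}.ncard : ℝ) : ℂ) := by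
  rw [ncard_tupleSet_sep, ternaryOp_eq_expect, weightScale]
  simp only [QuadraticFactor.prod_mu_eq, Fintype.prod_boole, apply_ite Complex.ofReal,
    Complex.ofReal_zero, mul_ite, mul_one, mul_zero, ← ite_and, Prod.forall]
  rw [expect_eq_sum_div_card, ← sum_filter, sum_const, nsmul_eq_mul]
  push_cast
  simp only [Function.comp, and_comm]
  ring

theorem ternaryOp_one_eq [Nonempty U] [Nonempty V] [Nonempty W] (B : QuadraticFactor p n l q)
    (e : LabelFamily p l q U V W) :
    ternaryOp B e (fun _ _ _ _ => 1) = ((weightScale B e * (tupleSet B e).ncard : ℝ) : ℂ) := by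
  simpa using ternaryOp_indicator B e fun _ _ _ _ => True

theorem ternaryOpPair_ind_eq [Nonempty U] [Nonempty V] [Nonempty W]
    (F : TripartiteHypergraph U V W) (B : QuadraticFactor p n l q) (e : LabelFamily p l q U V W)
    (A : Finset (Vec p n)) :
    ternaryOpPair F B e (ind A) (ind Aᶜ)
      = ((weightScale B e * (inducedCopies F B e A).ncard : ℝ) : ℂ) := by
  classical
  refine Eq.trans ?_ (ternaryOp_indicator B e fun u v w y => (y ∈ A ↔ F.IsEdge u v w))
  rw [ternaryOpPair]
  congr 1
  ext u v w y
  by_cases h : F.IsEdge u v w <;> by_cases hy : y ∈ A <;> simp [h, hy, ind]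

end Counting

section CountingLemma

variable {p n l q : ℕ}

theorem norm_ind_le_one (A : Finset (Vec p n)) (y : Vec p n) : ‖ind A y‖ ≤ 1 := by
  unfold ind
  split_ifs <;> simp

theorem norm_ind_sub_le_one (A : Finset (Vec p n)) {c : ℝ} (hc : c ∈ Set.Icc 0 1) (y : Vec p n) :
    ‖ind A y - c‖ ≤ 1 := by
  unfold ind
  split_ifs
  · rw [← Complex.ofReal_one, ← Complex.ofReal_sub, Complex.norm_real]
    exact abs_le.2 ⟨by linarith [hc.2], by linarith [hc.1]⟩
  · rw [zero_sub, norm_neg, Complex.norm_real]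
    exact abs_le.2 ⟨by linarith [hc.1], hc.2⟩

theorem QuadraticFactor.coe_le_rank_of_le {B : QuadraticFactor p n l q} {τ τ₀ : ℝ → ℝ}
    (hτ : ∀ x, 0 < x → τ₀ x ≤ τ x) (hB : (τ (l + q : ℕ) : EReal) ≤ B.rank) :
    (τ₀ (l + q : ℕ) : EReal) ≤ B.rank := by
  refine le_iInf₂ fun c hc => (EReal.coe_le_coe_iff.2 (hτ _ ?_)).trans (hB.trans (iInf₂_le c hc))
  obtain ⟨j, -⟩ := Function.ne_iff.1 hc
  exact_mod_cast Nat.add_pos_right l j.pos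

variable [Fact p.Prime]

theorem ind_compl (A : Finset (Vec p n)) (y : Vec p n) : ind Aᶜ y = 1 - ind A y := by
  by_cases hy : y ∈ A <;> simp [ind, hy]

theorem ite_ind_sub_ite (A : Finset (Vec p n)) (c : ℝ) (P : Prop) [Decidable P] :
    ((if P then ind A else ind Aᶜ) - fun _ => ((if P then c else 1 - c : ℝ) : ℂ)) =
        (fun x => ind A x - (c : ℂ)) ∨
      ((if P then ind A else ind Aᶜ) - fun _ => ((if P then c else 1 - c : ℝ) : ℂ)) =
        -fun x => ind A x - (c : ℂ) := by
  by_cases hP : P <;> [left; right] <;> ext x <;> simp [hP, ind_compl]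

theorem QuadraticFactor.density_mem_Icc (B : QuadraticFactor p n l q) (A : Finset (Vec p n))
    (a : AtomLabel p l q) : B.density A a ∈ Set.Icc 0 1 := by
  refine ⟨div_nonneg (by positivity) (by positivity), div_le_one_of_le₀ ?_ (by positivity)⟩
  exact_mod_cast card_le_card inter_subset_right

variable {U V W : Type*} [Fintype U] [Fintype V] [Fintype W]

open Classical in
theorem edgeProduct_eq (F : TripartiteHypergraph U V W) (α : U → V → W → ℝ) :
    edgeProduct F α = ∏ t : U × V × W,
      if F.IsEdge t.1 t.2.1 t.2.2 then α t.1 t.2.1 t.2.2 else 1 - α t.1 t.2.1 t.2.2 :=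
  (prod_ite _ _).symm

theorem edgeProduct_mem_Icc (F : TripartiteHypergraph U V W) {α : U → V → W → ℝ}
    (hα : ∀ u v w, α u v w ∈ Set.Icc 0 1) : edgeProduct F α ∈ Set.Icc 0 1 :=
  ⟨mul_nonneg (prod_nonneg fun _ _ => (hα _ _ _).1)
      (prod_nonneg fun _ _ => sub_nonneg.2 (hα _ _ _).2),
    mul_le_one₀ (prod_le_one (fun _ _ => (hα _ _ _).1) fun _ _ => (hα _ _ _).2)
      (prod_nonneg fun _ _ => sub_nonneg.2 (hα _ _ _).2)
      (prod_le_one (fun _ _ => sub_nonneg.2 (hα _ _ _).2) fun _ _ => sub_le_self _ (hα _ _ _).1)⟩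

theorem one_add_pow_mul_le {δ ε a : ℝ} (hδ₀ : 0 ≤ δ) (hδ : δ ≤ 1 / 20) (hε : 0 < ε)
    (hδε : δ ≤ ε ^ 16 / 8) (ha₀ : 0 ≤ a) (ha : a ≤ ε) :
    (1 + δ) ^ 7 * (a ^ 8 + √((1 + δ) * (4 * δ))) ≤ (2 * ε) ^ 8 := by
  have hpow : (1 + δ) ^ 7 ≤ 2 := by
    calc (1 + δ) ^ 7 ≤ (1 + 1 / 20) ^ 7 := by gcongr
      _ ≤ 2 := by norm_num
  have hsqrt : √((1 + δ) * (4 * δ)) ≤ ε ^ 8 := by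
    rw [Real.sqrt_le_left (by positivity)]
    nlinarith
  have hε8 : 0 ≤ ε ^ 8 := by positivity
  calc _ ≤ 2 * (ε ^ 8 + ε ^ 8) := by gcongr
    _ ≤ _ := by rw [mul_pow]; linarith

theorem abs_ncard_inducedCopies_sub_eq_zero_of_isEmpty [hempty : IsEmpty (U × V × W)]
    (F : TripartiteHypergraph U V W) (B : QuadraticFactor p n l q) (e : LabelFamily p l q U V W)
    (A : Finset (Vec p n)) (α : U → V → W → ℝ) :
    |(inducedCopies F B e A).ncard - edgeProduct F α * (tupleSet B e).ncard| = 0 := by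
  have hcopies : inducedCopies F B e A = tupleSet B e :=
    Set.ext fun t => and_iff_left fun u v w => hempty.elim (u, v, w)
  simp [hcopies, edgeProduct]

variable [DecidableEq U] [DecidableEq V] [DecidableEq W]

theorem exists_growthFunction_isQuasirandom {m : ℕ} (hm : 0 < m) {δ : ℝ} (hδ₀ : 0 < δ)
    (hδ : δ ≤ 1) :
    ∃ τ₀ : ℝ → ℝ, IsGrowthFunction τ₀ ∧ ∀ (p : ℕ) [Fact p.Prime], 2 < p →
      ∀ (n l q : ℕ) (U V W : Type*) [Fintype U] [Fintype V] [Fintype W] [DecidableEq U]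
        [DecidableEq V] [DecidableEq W], Fintype.card U ≤ m → Fintype.card V ≤ m →
        Fintype.card W ≤ m → ∀ (B : QuadraticFactor p n l q) (e : LabelFamily p l q U V W),
        (τ₀ (l + q : ℕ) : EReal) ≤ B.rank → e.IsQuasirandom B δ := by
  set K : ℕ := 2 * (3 * m) + (2 * (3 * m)) ^ 2
  have hK₀ : 0 < K := by positivity
  obtain ⟨s, hs⟩ := pow_unbounded_of_one_lt (2 * ((K : ℝ) + 2) / δ) (by norm_num : (1 : ℝ) < 3)
  refine ⟨fun x => 2 * (K * x + s), ⟨fun x _ y _ hxy => ?_, fun x hx => by positivity⟩,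
    fun p _ hp n l q U V W _ _ _ _ _ _ hU hV hW B e hB => ?_⟩
  · dsimp only
    gcongr
  have hcard : Fintype.card (U ⊕ V ⊕ W) ≤ 3 * m := by
    rw [Fintype.card_sum, Fintype.card_sum]
    lia
  refine e.isQuasirandom hp (fun c hc => ?_) hK₀ (by dsimp only [K]; gcongr) hδ
    ((div_le_comm₀ hδ₀ (by positivity)).1 hs.le)
  have hrank : 2 * (K * ((l + q : ℕ) : ℝ) + s) ≤ (∑ j, c j • B.M j).rank :=
    EReal.coe_le_coe_iff.1 (hB.trans (iInf₂_le c hc))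
  exact_mod_cast hrank

variable {B : QuadraticFactor p n l q} {e : LabelFamily p l q U V W} {δ ε : ℝ}

open Classical in
theorem edgeProduct_mul_ternaryOp_one (F : TripartiteHypergraph U V W)
    (B : QuadraticFactor p n l q) (e : LabelFamily p l q U V W) (α : U → V → W → ℝ) :
    (edgeProduct F α : ℂ) * ternaryOp B e (fun _ _ _ _ => 1) =
      ternaryOp B e fun u v w _ => ((if F.IsEdge u v w then α u v w else 1 - α u v w : ℝ) : ℂ) := by
  rw [edgeProduct_eq, Complex.ofReal_prod, ternaryOp_const B e fun u v w =>
    ((if F.IsEdge u v w then α u v w else 1 - α u v w : ℝ) : ℂ)]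

theorem LabelFamily.IsQuasirandom.norm_ternaryOp_le (h : e.IsQuasirandom B δ) (hδ : δ ≤ 1 / 20)
    (hε : 0 < ε) (hδε : δ ≤ ε ^ 16 / 8) {f : U → V → W → Vec p n → ℂ}
    (hf : ∀ u v w y, ‖f u v w y‖ ≤ 1) (u : U) (v : V) (w : W)
    (hU : B.localU3Norm (e.tuple u v w) (f u v w) ≤ ε) : ‖ternaryOp B e f‖ ≤ 2 * ε :=
  le_of_pow_le_pow_left₀ (by norm_num) (by positivity)
    ((h.norm_ternaryOp_pow_eight_le (by linarith) hf u v w).trans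
      (one_add_pow_mul_le h.delta_nonneg hδ hε hδε (localU3Norm_nonneg _ _ _) hU))

theorem LabelFamily.IsQuasirandom.norm_ternaryOpPair_sub_mul_le (h : e.IsQuasirandom B δ)
    (hδ : δ ≤ 1 / 20) (hε : 0 < ε) (hδε : δ ≤ ε ^ 16 / 8) (F : TripartiteHypergraph U V W)
    {A : Finset (Vec p n)} {α : U → V → W → ℝ} (hα : ∀ u v w, α u v w ∈ Set.Icc 0 1)
    (hU : ∀ u v w, B.localU3Norm (e.tuple u v w) (fun x => ind A x - α u v w) ≤ ε) :
    ‖ternaryOpPair F B e (ind A) (ind Aᶜ) -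
        edgeProduct F α * ternaryOp B e fun _ _ _ _ => 1‖
      ≤ Fintype.card (U × V × W) * (2 * ε) := by
  classical
  let f (t : U × V × W) : Vec p n → ℂ := if F.IsEdge t.1 t.2.1 t.2.2 then ind A else ind Aᶜ
  let g (t : U × V × W) (_ : Vec p n) : ℂ :=
    ((if F.IsEdge t.1 t.2.1 t.2.2 then α t.1 t.2.1 t.2.2 else 1 - α t.1 t.2.1 t.2.2 : ℝ) : ℂ)
  have hsub t : (f t - g t = fun x => ind A x - (α t.1 t.2.1 t.2.2 : ℂ)) ∨
      f t - g t = -fun x => ind A x - (α t.1 t.2.1 t.2.2 : ℂ) := ite_ind_sub_ite A _ _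
  have hf t y : ‖f t y‖ ≤ 1 := by
    dsimp only [f]
    split_ifs <;> exact norm_ind_le_one _ y
  have hg t y : ‖g t y‖ ≤ 1 := by
    have hα := hα t.1 t.2.1 t.2.2
    rw [Complex.norm_real, Real.norm_eq_abs, abs_le]
    split_ifs <;> constructor <;> linarith [hα.1, hα.2]
  have hfg t y : ‖f t y - g t y‖ ≤ 1 := by
    rw [← Pi.sub_apply (f t)]
    rcases hsub t with ht | ht <;> rw [ht]
    · exact norm_ind_sub_le_one A (hα _ _ _) y
    · exact (norm_neg _).trans_le (norm_ind_sub_le_one A (hα _ _ _) y)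
  have hfgU t : B.localU3Norm (e.tuple t.1 t.2.1 t.2.2) (f t - g t) ≤ ε := by
    rcases hsub t with ht | ht <;> rw [ht]
    · exact hU _ _ _
    · exact (localU3Norm_neg _ _ _).trans_le (hU _ _ _)
  rw [edgeProduct_mul_ternaryOp_one]
  have htele := norm_ternaryOp_sub_le (B := B) (e := e) hf hg hfg fun k t hk ht =>
    h.norm_ternaryOp_le hδ hε hδε (f := fun u v w => k (u, v, w)) (fun _ _ _ => hk _)
      t.1 t.2.1 t.2.2 (ht ▸ hfgU t)
  exact htele

theorem LabelFamily.IsQuasirandom.norm_ternaryOpPair_sub_edgeProduct_le (h : e.IsQuasirandom B δ)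
    (hδ : δ ≤ 1 / 20) (hε : 0 < ε) (hδε : δ ≤ ε ^ 16 / 8) (F : TripartiteHypergraph U V W)
    {A : Finset (Vec p n)} {α : U → V → W → ℝ} (hα : ∀ u v w, α u v w ∈ Set.Icc 0 1)
    (hU : ∀ u v w, B.localU3Norm (e.tuple u v w) (fun x => ind A x - α u v w) ≤ ε) :
    ‖ternaryOpPair F B e (ind A) (ind Aᶜ) - edgeProduct F α‖
      ≤ Fintype.card (U × V × W) * (2 * ε) + δ := by
  refine (norm_sub_le_norm_sub_add_norm_sub _ _ _).trans
    (add_le_add (h.norm_ternaryOpPair_sub_mul_le hδ hε hδε F hα hU) ?_)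
  have hP := edgeProduct_mem_Icc F hα
  rw [← mul_sub_one, norm_mul, Complex.norm_real, Real.norm_of_nonneg hP.1]
  exact (mul_le_of_le_one_left (norm_nonneg _) hP.2).trans
    (h.norm_ternaryOp_one_sub_one_le (by linarith))

theorem LabelFamily.IsQuasirandom.abs_ncard_inducedCopies_sub_le (h : e.IsQuasirandom B δ)
    (hδ : δ ≤ 1 / 20) (hε : 0 < ε) (hδε : δ ≤ ε ^ 16 / 8) (F : TripartiteHypergraph U V W)
    {A : Finset (Vec p n)} {α : U → V → W → ℝ} (hα : ∀ u v w, α u v w ∈ Set.Icc 0 1)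
    (hU : ∀ u v w, B.localU3Norm (e.tuple u v w) (fun x => ind A x - α u v w) ≤ ε) :
    |(inducedCopies F B e A).ncard - edgeProduct F α * (tupleSet B e).ncard|
      ≤ 4 * Fintype.card (U × V × W) * ε * (tupleSet B e).ncard := by
  rcases isEmpty_or_nonempty (U × V × W) with hempty | ⟨u₀, v₀, w₀⟩
  · rw [abs_ncard_inducedCopies_sub_eq_zero_of_isEmpty]
    positivity
  have : Nonempty U := ⟨u₀⟩
  have : Nonempty V := ⟨v₀⟩
  have : Nonempty W := ⟨w₀⟩
  have hpair := h.norm_ternaryOpPair_sub_mul_le hδ hε hδε F hα hU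
  have hone := h.norm_ternaryOp_one_sub_one_le (by linarith)
  rw [ternaryOp_one_eq, ternaryOpPair_ind_eq, ← Complex.ofReal_mul, ← Complex.ofReal_sub,
    Complex.norm_real, Real.norm_eq_abs, mul_left_comm, ← mul_sub, abs_mul,
    abs_of_nonneg (weightScale_nonneg B e)] at hpair
  rw [ternaryOp_one_eq, ← Complex.ofReal_one, ← Complex.ofReal_sub, Complex.norm_real] at hone
  have hhalf : 1 / 2 ≤ weightScale B e * (tupleSet B e).ncard := by linarith [(abs_le.1 hone).1]
  have hscale : 0 < weightScale B e :=
    pos_of_mul_pos_left (one_half_pos.trans_le hhalf) (by positivity)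
  refine le_of_mul_le_mul_left (hpair.trans ?_) hscale
  calc Fintype.card (U × V × W) * (2 * ε)
      = 4 * Fintype.card (U × V × W) * ε * (1 / 2) := by ring
    _ ≤ 4 * Fintype.card (U × V × W) * ε * (weightScale B e * (tupleSet B e).ncard) := by gcongr
    _ = _ := by ring

end CountingLemma

end TernaryCount

open TernaryCount in
theorem mainTheorem7_general (m : ℕ) (hm : 0 < m) :
    ∃ C : ℝ, 0 < C ∧ ∀ ε : ℝ, 0 < ε → ∃ τ₀ : ℝ → ℝ, IsGrowthFunction τ₀ ∧
      ∀ (p : ℕ) [Fact p.Prime], 2 < p →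
      ∀ (n l q : ℕ) (U V W : Type*) [Fintype U] [Fintype V] [Fintype W] [DecidableEq U]
        [DecidableEq V] [DecidableEq W], Fintype.card U ≤ m → Fintype.card V ≤ m →
        Fintype.card W ≤ m →
      ∀ (F : TripartiteHypergraph U V W) (B : QuadraticFactor p n l q),
        (τ₀ (l + q : ℕ) : EReal) ≤ B.rank →
      ∀ (A : Finset (Vec p n)) (e : LabelFamily p l q U V W) (α : U → V → W → ℝ),
        (∀ u v w, α u v w ∈ Set.Icc 0 1) →
        (∀ u v w, B.localU3Norm (e.tuple u v w) (fun x => ind A x - α u v w) ≤ ε) →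
        ‖ternaryOpPair F B e (ind A) (ind Aᶜ) - edgeProduct F α‖ < 3 * ε * m ^ 3 ∧
        |(inducedCopies F B e A).ncard - edgeProduct F α * (tupleSet B e).ncard|
          ≤ C * ε * (tupleSet B e).ncard := by
  have hm3 : (1 : ℝ) ≤ (m : ℝ) ^ 3 := one_le_pow₀ (mod_cast hm)
  refine ⟨4 * m ^ 3, by positivity, fun ε hε => ?_⟩
  obtain ⟨δ, hδ₀, hδ, hδε, hδε'⟩ : ∃ δ > 0, δ ≤ 1 / 20 ∧ δ ≤ ε ^ 16 / 8 ∧ δ ≤ ε / 2 :=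
    ⟨min (1 / 20) (min (ε ^ 16 / 8) (ε / 2)), by positivity, by simp, by simp, by simp⟩
  obtain ⟨τ₀, hτ₀, hquasi⟩ := exists_growthFunction_isQuasirandom hm hδ₀ (by linarith)
  refine ⟨τ₀, hτ₀, fun p _ hp n l q U V W _ _ _ _ _ _ hU hV hW F B hB A e α hα hU3 => ?_⟩
  have h := hquasi p hp n l q U V W hU hV hW B e hB
  have hcard : (Fintype.card (U × V × W) : ℝ) ≤ m ^ 3 := by
    rw [Fintype.card_prod, Fintype.card_prod, pow_succ', sq]
    exact_mod_cast Nat.mul_le_mul hU (Nat.mul_le_mul hV hW)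
  constructor
  · calc _ ≤ Fintype.card (U × V × W) * (2 * ε) + δ :=
          h.norm_ternaryOpPair_sub_edgeProduct_le hδ hε hδε F hα hU3
      _ ≤ m ^ 3 * (2 * ε) + ε / 2 := by gcongr
      _ < 3 * ε * m ^ 3 := by nlinarith
  · refine (h.abs_ncard_inducedCopies_sub_le hδ hε hδε F hα hU3).trans ?_
    gcongr

theorem mainTheorem7 (m : ℕ) (hm : 0 < m) :
    ∃ C : ℝ, 0 < C ∧ ∀ ε : ℝ, 0 < ε →
      ∃ τ₀ : ℝ → ℝ, TernaryCount.IsGrowthFunction τ₀ ∧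
        ∀ τ : ℝ → ℝ, TernaryCount.IsGrowthFunction τ → (∀ x, 0 < x → τ₀ x ≤ τ x) →
        ∀ (p : ℕ) [Fact p.Prime], 2 < p →
        ∀ (n l q : ℕ) (U V W : Finset (Fin m)) (F : TernaryCount.TripartiteHypergraph U V W)
          (B : TernaryCount.QuadraticFactor p n l q),
          ((τ ((l + q : ℕ) : ℝ) : ℝ) : EReal) ≤ B.rank →
        ∀ (A : Finset (TernaryCount.Vec p n)) (e : TernaryCount.LabelFamily p l q U V W)
          (α : U → V → W → ℝ),
          (∀ u v w, α u v w = B.density A (e.tuple u v w).sigma) →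
          (∀ u v w, B.localU3Norm (e.tuple u v w)
            (fun x => TernaryCount.ind A x - (α u v w : ℂ)) ≤ ε) →
          ‖TernaryCount.ternaryOpPair F B e (TernaryCount.ind A) (TernaryCount.ind Aᶜ)
              - (TernaryCount.edgeProduct F α : ℂ)‖ < 3 * ε * (m : ℝ) ^ 3 ∧
          |((TernaryCount.inducedCopies F B e A).ncard : ℝ)
              - TernaryCount.edgeProduct F α * ((TernaryCount.tupleSet B e).ncard : ℝ)|
            ≤ C * ε * ((TernaryCount.tupleSet B e).ncard : ℝ) := by
  have hcard (S : Finset (Fin m)) : Fintype.card S ≤ m := by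
    simpa using S.card_le_univ
  obtain ⟨C, hC, h⟩ := mainTheorem7_general m hm
  refine ⟨C, hC, fun ε hε => ?_⟩
  obtain ⟨τ₀, hτ₀, h⟩ := h ε hε
  refine ⟨τ₀, hτ₀, fun τ _ hτ p _ hp n l q U V W F B hB A e α hα hU => ?_⟩
  exact h p hp n l q U V W (hcard U) (hcard V) (hcard W) F B (B.coe_le_rank_of_le hτ hB) A e α
    (fun u v w => hα u v w ▸ B.density_mem_Icc A _) hU
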